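/- Let $A\in\mathbb R^{n_x\times n_x}$, $B\in\mathbb R^{n_x\times p}$, $\hat B\in\mathbb R^{n_x\times q}$, $C\in\mathbb R^{m\times n_x}$, $D\in\mathbb R^{m\times p}$, let $\lambda\in[0,\infty]$, and let $T_{\mathrm{desired}}$ be an $m\times q$ matrix function analytic on $|z|>1$. Let $\frac1z\mathcal{RH}_\infty$ denote the real rational, strictly proper transfer matrices all of whose poles lie in the open unit disk. For $\Phi_x,\Phi_u$ put $T=C\Phi_x\hat B+D\Phi_u\hat B-T_{\mathrm{desired}}$ and $$J(\Phi_x,\Phi_u)=\|T\|_{\mathcal H_2}+\lambda\|T\|_{\mathcal H_\infty},$$ where the norms are the Hardy norms on the exterior of the unit disk (Frobenius norm in $\mathcal H_2$, spectral norm in $\mathcal H_\infty$), and where $\lambda=\infty$ means $J=\|T\|_{\mathcal H_\infty}$. Let $J^*$ be the infimum of $J$ over all $\Phi_x,\Phi_u\in\frac1z\mathcal{RH}_\infty$ with $(zI-A)\Phi_x(z)-B\Phi_u(z)=I$. Assume that this infimum is attained and that $0<J^*<\infty$. Let $\sigma$ be the set of eigenvalues of $A$ and $m_s$ the algebraic multiplicity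 of $s\in\sigma$. For a finite subset $P$ of the open unit disk, let $J(P)$ be the infimum of $J$ over the pairs of the form $$\Phi_u(z)=\sum_{s\in P}\frac{H_s}{z-s},\qquad \Phi_x(z)=\sum_{s\in P\setminus\sigma}\frac{G_s}{z-s}+\sum_{s\in\sigma}\sum_{i=1}^{m_s+1}\frac{G_{(s,i)}}{(z-s)^i}$$ in $\frac1z\mathcal{RH}_\infty$ whose coefficient matrices satisfy, with $\tilde m_s=1$ if $s\in P$ and $\tilde m_s=0$ otherwise, $$\begin{aligned} &G_{(s,2)}+(sI-A)G_{(s,1)}-BH_s=0 && (s\in\sigma\cap P),\\ &(sI-A)G_s-BH_s=0 && (s\in P\setminus\sigma),\\ &G_{(s,i+1)}+(sI-A)G_{(s,i)}=0 && (s\in\sigma,\ 1+\tilde m_s\le i\le m_s),\\ &(sI-A)G_{(s,m_s+\tilde m_s)}=0 && (s\in\sigma),\\ &\textstyle\sum_{s\in P\setminus\sigma}G_s+\sum_{s\in\sigma}G_{(s,1)}=I. \end{aligned}$$ These equations express $(zI-A)\Phi_x-B\Phi_u=I$. For integers $n\ge1$ let $P_n$ consist of the points $\sqrt{k/n}\,e^{2i\sqrt{\pi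 k}}$, $1\le k\le n-1$, of an Archimedes spiral, together with their complex conjugates. Then there are constants $\hat K>0$ and $N>0$, depending only on the problem data and on an optimal solution $(\Phi_x^*,\Phi_u^*)$ and not on $n$, such that for all $n\ge N$ one has $|P_n|+2=2n$, the value $J(P_n)$ is finite, and $$\frac{J(P_n)-J^*}{J^*}\le\frac{\hat K}{\sqrt n}.$$ In particular the relative suboptimality is of order $(|P_n|+2)^{-1/2}$. -/

import Mathlib

open scoped ENNReal

noncomputable section

/-- A real matrix regarded as a complex one. -/
def cplx {a b : ℕ} (M : Matrix (Fin a) (Fin b) ℝ) : Matrix (Fin a) (Fin b) ℂ :=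
  M.map (fun x : ℝ => (x : ℂ))

/-- A real matrix regarded as a constant transfer matrix. -/
def constTF {a b : ℕ} (M : Matrix (Fin a) (Fin b) ℝ) : Matrix (Fin a) (Fin b) (RatFunc ℝ) :=
  M.map (fun x : ℝ => RatFunc.C x)

/-- Entrywise evaluation of a real rational transfer matrix at a complex point. -/
def evalTF {a b : ℕ} (Φ : Matrix (Fin a) (Fin b) (RatFunc ℝ)) (z : ℂ) :
    Matrix (Fin a) (Fin b) ℂ :=
  Φ.map (fun f : RatFunc ℝ => RatFunc.eval (algebraMap ℝ ℂ) z f)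

/-- Real rational, strictly proper and stable transfer matrices: the set `(1/z) RH_∞`.
`num` and `denom` of a `RatFunc` are coprime, so the roots of `denom` are exactly the poles. -/
def IsStrictlyProperStable {a b : ℕ} (Φ : Matrix (Fin a) (Fin b) (RatFunc ℝ)) : Prop :=
  ∀ i j, (Φ i j).num.degree < (Φ i j).denom.degree ∧
    ∀ z : ℂ, Polynomial.aeval z (Φ i j).denom = 0 → ‖z‖ < 1

/-- The squared Frobenius norm of a complex matrix. -/
def frobSq {a b : ℕ} (M : Matrix (Fin a) (Fin b) ℂ) : ℝ≥0∞ :=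
  ∑ i, ∑ j, ‖M i j‖ₑ ^ 2

/-- The Hardy `H₂` norm on the exterior of the closed unit disk. -/
def normH2 {a b : ℕ} (T : ℂ → Matrix (Fin a) (Fin b) ℂ) : ℝ≥0∞ :=
  ⨆ (r : ℝ) (_ : 1 < r),
    (ENNReal.ofReal (1 / (2 * Real.pi)) *
      ∫⁻ θ in Set.Ioc (0 : ℝ) (2 * Real.pi),
        frobSq (T ((r : ℂ) * Complex.exp ((θ : ℂ) * Complex.I)))) ^ (1 / 2 : ℝ)

section
open scoped Matrix.Norms.L2Operator

/-- The Hardy `H_∞` norm on the exterior of the closed unit disk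
(`‖T z‖ₑ` is the spectral norm, i.e. the `ℓ²` operator norm, of the matrix `T z`). -/
def normHinf {a b : ℕ} (T : ℂ → Matrix (Fin a) (Fin b) ℂ) : ℝ≥0∞ :=
  ⨆ (z : ℂ) (_ : 1 < ‖z‖), ‖T z‖ₑ

end

/-- The mixed objective with weight `lam ∈ [0, ∞]`; `lam = 0` is the pure `H₂` objective and
`lam = ∞` is the pure `H_∞` objective. -/
def mixedNorm {a b : ℕ} (lam : ℝ≥0∞) (T : ℂ → Matrix (Fin a) (Fin b) ℂ) : ℝ≥0∞ :=
  if lam = ⊤ then normHinf T else normH2 T + lam * normHinf T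

/-- The data of the state-feedback control design problem: the system
`x(k+1) = A x(k) + B u(k) + Bhat w(k)`, `y(k) = C x(k) + D u(k)`, the desired closed-loop transfer
function `Tdes` and the weight `lam`. -/
structure ControlProblem (n p q m : ℕ) where
  A : Matrix (Fin n) (Fin n) ℝ
  B : Matrix (Fin n) (Fin p) ℝ
  Bhat : Matrix (Fin n) (Fin q) ℝ
  C : Matrix (Fin m) (Fin n) ℝ
  D : Matrix (Fin m) (Fin p) ℝ
  Tdes : ℂ → Matrix (Fin m) (Fin q) ℂ
  lam : ℝ≥0∞

namespace ControlProblem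

variable {n p q m : ℕ} (S : ControlProblem n p q m)

/-- The objective value of a pair of closed-loop responses, as functions on `|z| > 1`. -/
def cost (Φx : ℂ → Matrix (Fin n) (Fin n) ℂ) (Φu : ℂ → Matrix (Fin p) (Fin n) ℂ) : ℝ≥0∞ :=
  mixedNorm S.lam (fun z =>
    cplx S.C * Φx z * cplx S.Bhat + cplx S.D * Φu z * cplx S.Bhat - S.Tdes z)

/-- Feasibility for the infinite-dimensional system level synthesis problem:
`(zI - A) Φx - B Φu = I` and `Φx, Φu ∈ (1/z) RH_∞`. -/
def Feasible (Φx : Matrix (Fin n) (Fin n) (RatFunc ℝ))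
    (Φu : Matrix (Fin p) (Fin n) (RatFunc ℝ)) : Prop :=
  (Matrix.scalar (Fin n) (RatFunc.X : RatFunc ℝ) - constTF S.A) * Φx - constTF S.B * Φu = 1 ∧
    IsStrictlyProperStable Φx ∧ IsStrictlyProperStable Φu

/-- The ground-truth optimal cost `J*`. -/
def Jstar : ℝ≥0∞ :=
  ⨅ (Φx : Matrix (Fin n) (Fin n) (RatFunc ℝ)) (Φu : Matrix (Fin p) (Fin n) (RatFunc ℝ))
    (_ : S.Feasible Φx Φu), S.cost (evalTF Φx) (evalTF Φu)

/-- `(Φx, Φu)` is an optimal solution of the infinite-dimensional problem. -/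
def IsOptimal (Φx : Matrix (Fin n) (Fin n) (RatFunc ℝ))
    (Φu : Matrix (Fin p) (Fin n) (RatFunc ℝ)) : Prop :=
  S.Feasible Φx Φu ∧ S.cost (evalTF Φx) (evalTF Φu) = S.Jstar

/-- The plant poles `σ`: the eigenvalues of `A`. -/
def plantPoles : Finset ℂ := (cplx S.A).charpoly.roots.toFinset

/-- The (algebraic) multiplicity `m_q` of a plant pole. -/
def mult (z : ℂ) : ℕ := (cplx S.A).charpoly.rootMultiplicity z

end ControlProblem

/-- Coefficient matrices of a simple pole approximation: `H z` and `G z` are the coefficients at a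
selected pole `z`, and `Gσ z i` is the coefficient of `1 / (ζ - z)^i` at a plant pole `z`. -/
structure SPACoeffs (n p : ℕ) where
  H : ℂ → Matrix (Fin p) (Fin n) ℂ
  G : ℂ → Matrix (Fin n) (Fin n) ℂ
  Gσ : ℂ → ℕ → Matrix (Fin n) (Fin n) ℂ

namespace ControlProblem

variable {n p q m : ℕ} (S : ControlProblem n p q m) (P : Finset ℂ) (c : SPACoeffs n p)

/-- `Φu(z) = ∑_{p ∈ P} H_p / (z - p)`. -/
def spaU (z : ℂ) : Matrix (Fin p) (Fin n) ℂ :=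
  ∑ s ∈ P, (z - s)⁻¹ • c.H s

/-- `Φx(z) = ∑_{p ∈ P - σ} G_p / (z - p) + ∑_{q ∈ σ} ∑_{i=1}^{m_q+1} G_{(q,i)} / (z - q)^i`. -/
def spaX (z : ℂ) : Matrix (Fin n) (Fin n) ℂ :=
  ∑ s ∈ P \ S.plantPoles, (z - s)⁻¹ • c.G s +
    ∑ s ∈ S.plantPoles, ∑ i ∈ Finset.Icc 1 (S.mult s + 1), ((z - s) ^ i)⁻¹ • c.Gσ s i

/-- `m̃_q`: it is `1` if `q ∈ P` and `0` otherwise. -/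
def mtilde (z : ℂ) : ℕ := if z ∈ P then 1 else 0

/-- `zI - A` at a complex number `z`. -/
def shift (z : ℂ) : Matrix (Fin n) (Fin n) ℂ := Matrix.scalar (Fin n) z - cplx S.A

/-- Feasibility of the coefficients of a simple pole approximation with poles `P`: the affine
system level synthesis constraints, together with `Φx ∈ (1/z) RH_∞` and `Φu ∈ (1/z) RH_∞`, which
for functions of this form with `P` inside the open unit disk means that the coefficients at plant
poles outside the open unit disk vanish and that the transfer functions are real. -/
structure SPAFeasible : Prop where
  sls_common : ∀ s ∈ S.plantPoles ∩ P,
    c.Gσ s 2 + S.shift s * c.Gσ s 1 - cplx S.B * c.H s = 0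
  sls_simple : ∀ s ∈ P \ S.plantPoles, S.shift s * c.G s - cplx S.B * c.H s = 0
  sls_chain : ∀ s ∈ S.plantPoles, ∀ i ∈ Finset.Icc (1 + mtilde P s) (S.mult s),
    c.Gσ s (i + 1) + S.shift s * c.Gσ s i = 0
  sls_last : ∀ s ∈ S.plantPoles, S.shift s * c.Gσ s (S.mult s + mtilde P s) = 0
  sls_sum : ∑ s ∈ P \ S.plantPoles, c.G s + ∑ s ∈ S.plantPoles, c.Gσ s 1 = 1
  stable : ∀ s ∈ S.plantPoles, 1 ≤ ‖s‖ → ∀ i ∈ Finset.Icc 1 (S.mult s + 1), c.Gσ s i = 0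
  real_u : ∀ z : ℂ, 1 < ‖z‖ →
    spaU P c (starRingEnd ℂ z) = (spaU P c z).map (starRingEnd ℂ)
  real_x : ∀ z : ℂ, 1 < ‖z‖ →
    S.spaX P c (starRingEnd ℂ z) = (S.spaX P c z).map (starRingEnd ℂ)

/-- The optimal cost `J(P)` of the simple pole approximation control design with poles `P`
(it is `∞` if that design problem is infeasible). -/
def Jspa : ℝ≥0∞ :=
  ⨅ (c : SPACoeffs n p) (_ : S.SPAFeasible P c), S.cost (S.spaX P c) (spaU P c)

end ControlProblem

/-- The `k`-th point `√(k/n) · exp(2 i √(π k))` of the Archimedes spiral. -/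
def spiralPole (n k : ℕ) : ℂ :=
  (Real.sqrt ((k : ℝ) / (n : ℝ)) : ℂ) *
    Complex.exp (((2 * Real.sqrt (Real.pi * (k : ℝ)) : ℝ) : ℂ) * Complex.I)

/-- The spiral pole selection `P_n`: the spiral points `k = 1, …, n - 1` and their conjugates. -/
def spiralPoles (n : ℕ) : Finset ℂ :=
  (Finset.Ico 1 n).image (spiralPole n) ∪
    (Finset.Ico 1 n).image (fun k => starRingEnd ℂ (spiralPole n k))

end

/-! An optimal pair is rational, so only finitely many poles have to be imitated, and the spiral has
points within O(1/√n) of each of them. Write the optimal pair as M/d, N/d, where d is a real product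
of conjugate pairs (r_i, r̄_i) in the open disk. Replace each r_i by its own nearby spiral point
w_i. Since coefficients depend differentiably on roots, the new denominator is d + e, with deg e <
deg d and coefficients of e of size O(1/√n).

Changing the denominator alone breaks the constraint: Φx = (zI - A)⁻¹(I + BΦu) could acquire poles
at eigenvalues of A, possibly unstable ones. Factor the characteristic polynomial as a₁a₂, with a₂
coprime to d and every root of a₁ a root of d, hence stable. Add to N a correction E with dE - eN =
a₂F, which is possible by Bézout. Then Φu changes by a₂F/(d(d+e)) and Φx by adj(zI -
A)BF/(a₁d(d+e)): a₂ has cancelled, and only stable poles remain. E and F are built linearly from the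
coefficients of e, so both changes are O(1/√n) uniformly on |z| > 1 (`exists_state_numerator`,
`exists_perturbed_response`).

The new Φu has simple poles at spiral points and their conjugates; the new Φx may also have poles at
the roots of a₁, with order bounded by the multiplicity in A, plus one at a selected pole. Partial
fractions then give the required ansatz, and their uniqueness turns the constraint into the
coefficient equations (`exists_spaCoeffs`). The triangle inequality for the H₂ and H_∞ norms bounds
the change in cost. -/

noncomputable section

/-! ### Geometry of the spiral: distinctness and approximation -/

theorem norm_spiralPole (n k : ℕ) : ‖spiralPole n k‖ = Real.sqrt ((k : ℝ) / n) := by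
  rw [spiralPole, norm_mul, Complex.norm_exp_ofReal_mul_I, mul_one, Complex.norm_real,
    Real.norm_of_nonneg (Real.sqrt_nonneg _)]

theorem spiralPole_norm_lt_one {n k : ℕ} (hk : k < n) : ‖spiralPole n k‖ < 1 := by
  have hn : (0 : ℝ) < n := by exact_mod_cast (Nat.zero_le k).trans_lt hk
  rw [norm_spiralPole, Real.sqrt_lt' one_pos, one_pow, div_lt_one hn]
  exact_mod_cast hk

theorem index_eq_of_norm_spiralPole_eq {n k l : ℕ} (hn : 0 < n)
    (h : ‖spiralPole n k‖ = ‖spiralPole n l‖) : k = l := by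
  have hn' : (0 : ℝ) < n := by exact_mod_cast hn
  rw [norm_spiralPole, norm_spiralPole, Real.sqrt_inj (by positivity) (by positivity),
    div_left_inj' hn'.ne'] at h
  exact_mod_cast h

/-- A vanishing sine would give 2√(πk) = jπ, hence j²π = 4k, against the irrationality of π. Since
the modulus determines the index, this separates all spiral points from all conjugates. -/
theorem spiralPole_im_ne_zero {n k : ℕ} (hn : 0 < n) (hk : 0 < k) : (spiralPole n k).im ≠ 0 := by
  have hn' : (0 : ℝ) < n := by exact_mod_cast hn
  have hk' : (0 : ℝ) < k := by exact_mod_cast hk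
  rw [spiralPole, Complex.im_ofReal_mul, Complex.exp_ofReal_mul_I_im]
  refine mul_ne_zero (Real.sqrt_pos.2 (by positivity)).ne' fun h => ?_
  obtain ⟨j, hj⟩ := Real.sin_eq_zero_iff.1 h
  have hsq : (j * Real.pi) ^ 2 = 4 * (Real.pi * k) := by
    rw [hj, mul_pow, Real.sq_sqrt (by positivity)]; norm_num
  have hpi := Real.pi_pos
  have hj2 : (j : ℝ) ^ 2 * Real.pi = 4 * k := by
    have : Real.pi * ((j : ℝ) ^ 2 * Real.pi) = Real.pi * (4 * k) := by linarith
    exact mul_left_cancel₀ hpi.ne' this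
  have hj0 : (j : ℝ) ^ 2 ≠ 0 := by
    intro h0
    rw [h0] at hj2
    linarith
  refine irrational_pi ⟨4 * k / (j : ℚ) ^ 2, ?_⟩
  push_cast
  rw [div_eq_iff hj0]
  linarith

theorem spiralPoles_card {n : ℕ} (hn : 0 < n) : (spiralPoles n).card + 2 = 2 * n := by
  rw [spiralPoles, Finset.card_union_of_disjoint, Finset.card_image_of_injOn,
    Finset.card_image_of_injOn, Nat.card_Ico]
  · omega
  · intro k _ l _ h
    exact index_eq_of_norm_spiralPole_eq hn (congrArg norm ((starRingEnd ℂ).injective h))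
  · intro k _ l _ h
    exact index_eq_of_norm_spiralPole_eq hn (congrArg norm h)
  · rw [Finset.disjoint_left]
    intro z hz hz'
    obtain ⟨k, hk, rfl⟩ := Finset.mem_image.1 hz
    obtain ⟨l, hl, h⟩ := Finset.mem_image.1 hz'
    have hkl : l = k := index_eq_of_norm_spiralPole_eq hn (by
      rw [← h]; exact (RCLike.norm_conj _).symm)
    subst hkl
    exact spiralPole_im_ne_zero hn (Finset.mem_Ico.1 hk).1 (Complex.conj_eq_iff_im.1 h)

theorem norm_ofReal_mul_exp_sub_le {a b α β : ℝ} (ha : 0 ≤ a) :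
    ‖(a : ℂ) * Complex.exp ((α : ℂ) * Complex.I) - b * Complex.exp ((β : ℂ) * Complex.I)‖
      ≤ |a - b| + a * |α - β| := by
  have h1 : (a : ℂ) * Complex.exp ((α : ℂ) * Complex.I) - b * Complex.exp ((β : ℂ) * Complex.I)
      = ((a - b : ℝ) : ℂ) * Complex.exp ((β : ℂ) * Complex.I)
        + a * (Complex.exp ((β : ℂ) * Complex.I) *
          (Complex.exp (Complex.I * ((α - β : ℝ) : ℂ)) - 1)) := by
    have : Complex.exp ((α : ℂ) * Complex.I) = Complex.exp ((β : ℂ) * Complex.I) *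
        Complex.exp (Complex.I * ((α - β : ℝ) : ℂ)) := by
      rw [← Complex.exp_add]; congr 1; push_cast; ring
    rw [this]; push_cast; ring
  rw [h1]
  refine (norm_add_le _ _).trans ?_
  rw [norm_mul, norm_mul, norm_mul, Complex.norm_exp_ofReal_mul_I, Complex.norm_real,
    Complex.norm_real, mul_one, one_mul, Real.norm_eq_abs, Real.norm_of_nonneg ha]
  gcongr
  exact Real.norm_exp_I_mul_ofReal_sub_one_le

/-- Every point of the open disk has many spiral points within distance `O(1/√n)`. -/
theorem exists_spiralPole_near (M : ℕ) (r : ℂ) (hr : ‖r‖ < 1) :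
    ∃ K : ℝ, ∃ N : ℕ, ∀ n ≥ N, ∃ b : ℕ, ∀ t < M, b + t ∈ Finset.Ico 1 n ∧
      ‖spiralPole n (b + t) - r‖ ≤ K / Real.sqrt n := by
  set w : ℝ := Real.sqrt Real.pi with hw
  have hw0 : 0 < w := Real.sqrt_pos.2 Real.pi_pos
  have hww : w * w = Real.pi := Real.mul_self_sqrt Real.pi_pos.le
  -- This threshold gives √n (1 - ‖r‖) > w + M + 1, which keeps all M chosen indices below n.
  obtain ⟨N, hN⟩ := exists_nat_gt (((w + M + 1) / (1 - ‖r‖)) ^ 2)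
  refine ⟨M + 2 * w * M + w, N + 1, fun n hn => ?_⟩
  have hn0 : 0 < n := by omega
  have hn' : (0 : ℝ) < n := by exact_mod_cast hn0
  set s : ℝ := Real.sqrt n with hs
  have hs0 : 0 < s := Real.sqrt_pos.2 hn'
  have hss : s * s = n := Real.mul_self_sqrt hn'.le
  have h1r : 0 < 1 - ‖r‖ := by linarith
  have hsbig : w + M + 1 < s * (1 - ‖r‖) := by
    rw [← div_lt_iff₀ h1r]
    refine Real.lt_sqrt_of_sq_lt (hN.trans ?_)
    exact_mod_cast hn
  -- the angle on the turn of the spiral which passes just outside `r`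
  obtain ⟨j, hj, -⟩ := existsUnique_add_zsmul_mem_Ico (a := 2 * Real.pi) Real.two_pi_pos
    r.arg (2 * w * s * ‖r‖)
  set θ : ℝ := r.arg + j • (2 * Real.pi) with hθ
  set x : ℝ := θ / (2 * w) with hx
  have hθx : θ = 2 * w * x := by rw [hx]; field_simp
  have hx1 : s * ‖r‖ ≤ x := by
    rw [hx, le_div_iff₀ (by positivity)]; linarith [hj.1]
  have hx2 : x < s * ‖r‖ + w := by
    rw [hx, div_lt_iff₀ (by positivity)]
    have := hj.2
    nlinarith
  have hx0 : 0 ≤ x := le_trans (by positivity) hx1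
  have hre : r = (‖r‖ : ℂ) * Complex.exp ((θ : ℂ) * Complex.I) := by
    conv_lhs => rw [← Complex.norm_mul_exp_arg_mul_I r]
    congr 1
    rw [hθ, show ((r.arg + j • (2 * Real.pi) : ℝ) : ℂ) * Complex.I
      = (r.arg : ℂ) * Complex.I + j * (2 * Real.pi * Complex.I) by push_cast; simp; ring,
      Complex.exp_add, Complex.exp_int_mul_two_pi_mul_I, mul_one]
  -- In the parameter y = √k the spiral has radius y/√n and angle 2wy, so y = x is where it crosses
  -- the ray through r. Indices k in [x², x² + M] satisfy y(y - x) ≤ y² - x² ≤ M. This bounds the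
  -- radial error by (M + w)/√n and the angular one by 2wM/√n.
  refine ⟨⌊x ^ 2⌋₊ + 1, fun t ht => ?_⟩
  set k : ℕ := ⌊x ^ 2⌋₊ + 1 + t with hk
  have hkx1 : x ^ 2 ≤ k := by
    have := Nat.lt_floor_add_one (x ^ 2)
    rw [hk]; push_cast
    have : (0 : ℝ) ≤ t := by positivity
    linarith
  have hkx2 : (k : ℝ) ≤ x ^ 2 + M := by
    have h1 := Nat.floor_le (sq_nonneg x)
    have h2 : (t : ℝ) + 1 ≤ M := by exact_mod_cast ht
    rw [hk]; push_cast; linarith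
  have hk1 : 1 ≤ k := by omega
  have hk0 : (1 : ℝ) ≤ k := by exact_mod_cast hk1
  set y : ℝ := Real.sqrt k with hy
  have hyy : y * y = k := Real.mul_self_sqrt (by positivity)
  have hy0 : 0 < y := Real.sqrt_pos.2 (by positivity)
  have hxy : x ≤ y := Real.le_sqrt_of_sq_le hkx1
  have hM0 : (0 : ℝ) ≤ M := by positivity
  have hy1 : 1 ≤ y := Real.one_le_sqrt.2 hk0
  have hyx : y * (y - x) ≤ M := by nlinarith
  have hyx' : y - x ≤ M := by nlinarith
  refine ⟨Finset.mem_Ico.2 ⟨hk1, ?_⟩, ?_⟩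
  · have : (k : ℝ) < n := by
      have : y < s := by nlinarith
      nlinarith
    exact_mod_cast this
  · have h1 : Real.sqrt ((k : ℝ) / n) = y / s := Real.sqrt_div (by positivity) _
    have h2 : 2 * Real.sqrt (Real.pi * k) = 2 * w * y := by
      rw [Real.sqrt_mul Real.pi_pos.le]; ring
    rw [spiralPole, h1, h2]
    conv_lhs => rw [hre]
    refine (norm_ofReal_mul_exp_sub_le (by positivity)).trans ?_
    have e1 : y / s - ‖r‖ = (y - s * ‖r‖) / s := by field_simp
    have e2 : 2 * w * y - θ = 2 * w * (y - x) := by rw [hθx]; ring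
    rw [e1, e2, abs_of_nonneg (div_nonneg (by linarith) hs0.le),
      abs_of_nonneg (mul_nonneg (by positivity) (by linarith)), div_mul_eq_mul_div, ← add_div]
    refine div_le_div_of_nonneg_right ?_ hs0.le
    have h3 : w * (y * (y - x)) ≤ w * M := mul_le_mul_of_nonneg_left hyx hw0.le
    linarith

/-- Repeated poles must go to different spiral points for the new poles to be simple. Each r_i has D
admissible indices and there are only D of them, so Hall's condition holds. -/
theorem exists_injective_spiralPole_near {D : ℕ} (r : Fin D → ℂ) (hr : ∀ i, ‖r i‖ < 1) :
    ∃ K : ℝ, ∃ N : ℕ, ∀ n ≥ N, ∃ k : Fin D → ℕ, Function.Injective k ∧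
      ∀ i, k i ∈ Finset.Ico 1 n ∧ ‖spiralPole n (k i) - r i‖ ≤ K / Real.sqrt n := by
  choose K N h using fun i => exists_spiralPole_near D (r i) (hr i)
  refine ⟨∑ i, |K i|, ∑ i, N i, fun n hn => ?_⟩
  have hNi : ∀ i, N i ≤ n := fun i =>
    (Finset.single_le_sum (f := N) (fun _ _ => Nat.zero_le _) (Finset.mem_univ i)).trans hn
  choose b hb using fun i => h i n (hNi i)
  let S : Fin D → Finset ℕ := fun i => (Finset.range D).image (fun t => b i + t)
  have hS : ∀ i, (S i).card = D := fun i => by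
    rw [Finset.card_image_of_injective _ (add_right_injective _), Finset.card_range]
  obtain ⟨k, hk, hkS⟩ := (Finset.all_card_le_biUnion_card_iff_exists_injective S).1 (by
    intro s
    rcases s.eq_empty_or_nonempty with rfl | ⟨i, hi⟩
    · simp
    · calc s.card ≤ D := by simpa using Finset.card_le_univ s
        _ = (S i).card := (hS i).symm
        _ ≤ _ := Finset.card_le_card (Finset.subset_biUnion_of_mem S hi))
  refine ⟨k, hk, fun i => ?_⟩
  obtain ⟨t, ht, hti⟩ := Finset.mem_image.1 (hkS i)
  obtain ⟨h1, h2⟩ := hb i t (Finset.mem_range.1 ht)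
  rw [← hti]
  refine ⟨h1, h2.trans ?_⟩
  gcongr
  exact (le_abs_self _).trans
    (Finset.single_le_sum (f := fun i => |K i|) (fun _ _ => abs_nonneg _) (Finset.mem_univ i))

end

/-! ### Real polynomials with prescribed conjugate roots: perturbation and growth -/

noncomputable section

/-- The real quadratic polynomial with roots `z` and its complex conjugate. -/
def conjQuad (z : ℂ) : Polynomial ℝ :=
  Polynomial.X ^ 2 - Polynomial.C (2 * z.re) * Polynomial.X + Polynomial.C (Complex.normSq z)

/-- The real polynomial with roots `p i` and their complex conjugates. -/
def conjProd {D : ℕ} (p : Fin D → ℂ) : Polynomial ℝ := ∏ i, conjQuad (p i)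

open Polynomial in
theorem conjQuad_map (z : ℂ) : (conjQuad z).map (algebraMap ℝ ℂ) =
    (X - C z) * (X - C (starRingEnd ℂ z)) := by
  have h1 : ((2 * z.re : ℝ) : ℂ) = z + starRingEnd ℂ z := by
    rw [Complex.add_conj]
  have h2 : ((Complex.normSq z : ℝ) : ℂ) = z * starRingEnd ℂ z := by
    rw [Complex.mul_conj]
  simp only [conjQuad, Polynomial.map_add, Polynomial.map_sub, Polynomial.map_pow,
    Polynomial.map_mul, map_X, map_C, Complex.coe_algebraMap, h1, h2]
  rw [C_add, C_mul]
  ring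

theorem conjProd_map {D : ℕ} (p : Fin D → ℂ) : (conjProd p).map (algebraMap ℝ ℂ) =
    ∏ i, ((Polynomial.X - Polynomial.C (p i)) *
      (Polynomial.X - Polynomial.C (starRingEnd ℂ (p i)))) := by
  simp only [conjProd, Polynomial.map_prod, conjQuad_map]

theorem conjQuad_monic (z : ℂ) : (conjQuad z).Monic := by
  refine Polynomial.monic_of_injective (algebraMap ℝ ℂ).injective ?_
  rw [conjQuad_map]
  exact (Polynomial.monic_X_sub_C _).mul (Polynomial.monic_X_sub_C _)

theorem conjQuad_natDegree (z : ℂ) : (conjQuad z).natDegree = 2 := by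
  rw [← Polynomial.natDegree_map (algebraMap ℝ ℂ), conjQuad_map,
    (Polynomial.monic_X_sub_C _).natDegree_mul (Polynomial.monic_X_sub_C _),
    Polynomial.natDegree_X_sub_C, Polynomial.natDegree_X_sub_C]

theorem conjProd_monic {D : ℕ} (p : Fin D → ℂ) : (conjProd p).Monic :=
  Polynomial.monic_prod_of_monic _ _ fun i _ => conjQuad_monic (p i)

theorem conjProd_natDegree {D : ℕ} (p : Fin D → ℂ) : (conjProd p).natDegree = 2 * D := by
  rw [conjProd, Polynomial.natDegree_prod_of_monic _ _ fun i _ => conjQuad_monic (p i)]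
  simp [conjQuad_natDegree, mul_comm]

theorem conjQuad_coeff_differentiable {D : ℕ} (i : Fin D) (j : ℕ) :
    Differentiable ℝ fun p : Fin D → ℂ => (conjQuad (p i)).coeff j := by
  have hre : Differentiable ℝ fun p : Fin D → ℂ => (p i).re :=
    Complex.reCLM.differentiable.comp (differentiable_apply i)
  have him : Differentiable ℝ fun p : Fin D → ℂ => (p i).im :=
    Complex.imCLM.differentiable.comp (differentiable_apply i)
  simp only [conjQuad, Polynomial.coeff_add, Polynomial.coeff_sub, Polynomial.coeff_C_mul,
    Polynomial.coeff_C, Complex.normSq_apply]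
  split_ifs <;> fun_prop

theorem prod_conjQuad_coeff_differentiable {D : ℕ} (s : Finset (Fin D)) (j : ℕ) :
    Differentiable ℝ fun p : Fin D → ℂ => (∏ i ∈ s, conjQuad (p i)).coeff j := by
  induction s using Finset.induction_on generalizing j with
  | empty => simp
  | insert a s ha ih =>
    simp only [Finset.prod_insert ha, Polynomial.coeff_mul]
    exact Differentiable.fun_sum fun x _ =>
      (conjQuad_coeff_differentiable a x.1).mul (ih x.2)

/-- Each coefficient is a real-differentiable function of the roots, hence Lipschitz at r. Only the
coefficients up to degree 2D can be nonzero, so one constant and one neighbourhood serve all of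
them. -/
theorem conjProd_perturbation {D : ℕ} (r : Fin D → ℂ) (hr : ∀ i, ‖r i‖ < 1) :
    ∃ C ≥ (0 : ℝ), ∃ ρ < (1 : ℝ), 0 ≤ ρ ∧ ∃ δ > (0 : ℝ), ∀ p : Fin D → ℂ, ∀ η < δ, 0 ≤ η →
      (∀ i, ‖p i - r i‖ ≤ η) →
      (∀ i, ‖p i‖ ≤ ρ) ∧ ∀ j, |(conjProd p - conjProd r).coeff j| ≤ C * η := by
  have hC : ∀ j : ℕ, ∃ C : ℝ, ∀ᶠ p in nhds r,
      ‖(conjProd p).coeff j - (conjProd r).coeff j‖ ≤ C * ‖p - r‖ := fun j =>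
    ((prod_conjQuad_coeff_differentiable Finset.univ j).differentiableAt (x := r)).isBigO_sub.bound
  choose C hC using hC
  obtain ⟨ρ, hρ1, hρ0, hρ⟩ : ∃ ρ < (1 : ℝ), 0 ≤ ρ ∧ ∀ᶠ p in nhds r, ∀ i, ‖p i‖ ≤ ρ := by
    have hr' : ‖r‖ < 1 := (pi_norm_lt_iff one_pos).2 hr
    refine ⟨(1 + ‖r‖) / 2, by linarith, by positivity, ?_⟩
    have : ∀ᶠ p in nhds r, ‖p‖ < (1 + ‖r‖) / 2 :=
      continuous_norm.continuousAt.eventually (gt_mem_nhds (by linarith))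
    filter_upwards [this] with p hp i using (norm_le_pi_norm p i).trans hp.le
  have hev : ∀ᶠ p in nhds r, (∀ i, ‖p i‖ ≤ ρ) ∧ ∀ j ∈ Finset.range (2 * D + 1),
      ‖(conjProd p).coeff j - (conjProd r).coeff j‖ ≤ C j * ‖p - r‖ :=
    hρ.and ((Filter.eventually_all_finset _).2 fun j _ => hC j)
  obtain ⟨δ, hδ, hball⟩ := Metric.eventually_nhds_iff.1 hev
  refine ⟨∑ j ∈ Finset.range (2 * D + 1), |C j|, by positivity, ρ, hρ1, hρ0, δ, hδ,
    fun p η hη hη0 hp => ?_⟩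
  have hpr : ‖p - r‖ ≤ η := (pi_norm_le_iff_of_nonneg hη0).2 hp
  obtain ⟨h1, h2⟩ := hball (y := p) (by rw [dist_eq_norm]; linarith)
  refine ⟨h1, fun j => ?_⟩
  rw [Polynomial.coeff_sub]
  by_cases hj : j ∈ Finset.range (2 * D + 1)
  · refine (h2 j hj).trans ?_
    have h3 : C j ≤ ∑ j ∈ Finset.range (2 * D + 1), |C j| := (le_abs_self _).trans
      (Finset.single_le_sum (f := fun j => |C j|) (fun _ _ => abs_nonneg _) hj)
    refine (mul_le_mul_of_nonneg_right h3 (norm_nonneg _)).trans ?_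
    exact mul_le_mul_of_nonneg_left hpr (by positivity)
  · rw [Finset.mem_range, not_lt] at hj
    rw [Polynomial.coeff_eq_zero_of_natDegree_lt (by rw [conjProd_natDegree]; omega),
      Polynomial.coeff_eq_zero_of_natDegree_lt (by rw [conjProd_natDegree]; omega)]
    simp only [sub_self, abs_zero]
    positivity

theorem Polynomial.norm_aeval_le (f : Polynomial ℝ) {k : ℕ} (hf : f.natDegree ≤ k) {z : ℂ}
    (hz : 1 ≤ ‖z‖) :
    ‖Polynomial.aeval z f‖ ≤ (∑ j ∈ Finset.range (k + 1), |f.coeff j|) * ‖z‖ ^ k := by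
  rw [Polynomial.aeval_eq_sum_range' (Nat.lt_succ_of_le hf), Finset.sum_mul]
  refine (norm_sum_le _ _).trans (Finset.sum_le_sum fun j hj => ?_)
  rw [norm_smul, norm_pow, Real.norm_eq_abs]
  exact mul_le_mul_of_nonneg_left
    (pow_le_pow_right₀ hz (Nat.lt_succ_iff.1 (Finset.mem_range.1 hj))) (abs_nonneg _)

/-- Every linear factor satisfies |z - a| ≥ |z| - ρ ≥ (1 - ρ)|z| once |z| ≥ 1. Together with
`Polynomial.norm_aeval_le` this bounds proper stable fractions by their numerator coefficients. -/
theorem Polynomial.pow_natDegree_le_norm_aeval {f : Polynomial ℝ} (hf : f.Monic) {ρ : ℝ}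
    (hρ1 : ρ < 1) (hρ0 : 0 ≤ ρ) (hroot : ∀ s : ℂ, Polynomial.aeval s f = 0 → ‖s‖ ≤ ρ) {z : ℂ}
    (hz : 1 ≤ ‖z‖) :
    ((1 - ρ) * ‖z‖) ^ f.natDegree ≤ ‖Polynomial.aeval z f‖ := by
  set g := f.map (algebraMap ℝ ℂ) with hg
  have hgm : g.Monic := hf.map _
  have hs := IsAlgClosed.splits g
  have hcard : g.roots.card = f.natDegree := by
    rw [← hs.natDegree_eq_card_roots, hg, Polynomial.natDegree_map]
  have hev : Polynomial.aeval z f = (g.roots.map fun a => z - a).prod := by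
    rw [Polynomial.aeval_def, ← Polynomial.eval_map, ← hg,
      hs.eval_eq_prod_roots_of_monic hgm]
  have hroots : ∀ a ∈ g.roots, ‖a‖ ≤ ρ := fun a ha => hroot a (by
    rw [Polynomial.aeval_def, ← Polynomial.eval_map]
    exact (Polynomial.mem_roots'.1 ha).2)
  rw [hev, ← hcard]
  have key : ∀ m : Multiset ℂ, (∀ a ∈ m, ‖a‖ ≤ ρ) →
      ((1 - ρ) * ‖z‖) ^ m.card ≤ ‖(m.map fun a => z - a).prod‖ := by
    intro m
    induction m using Multiset.induction_on with
    | empty => simp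
    | cons a m ih =>
      intro hm
      rw [Multiset.card_cons, Multiset.map_cons, Multiset.prod_cons, norm_mul, pow_succ, mul_comm]
      refine mul_le_mul ?_ (ih fun b hb => hm b (Multiset.mem_cons_of_mem hb)) ?_ (norm_nonneg _)
      · have h1 := norm_sub_norm_le z a
        have h2 := hm a (Multiset.mem_cons_self _ _)
        nlinarith
      · have : 0 ≤ 1 - ρ := by linarith
        positivity
  exact key _ hroots

theorem Polynomial.exists_root_bound {f : Polynomial ℝ} (hf : f ≠ 0)
    (hroot : ∀ s : ℂ, Polynomial.aeval s f = 0 → ‖s‖ < 1) :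
    ∃ ρ < (1 : ℝ), 0 ≤ ρ ∧ ∀ s : ℂ, Polynomial.aeval s f = 0 → ‖s‖ ≤ ρ := by
  have hfin : (f.rootSet ℂ).Finite := Polynomial.rootSet_finite f ℂ
  have hmem : ∀ s : ℂ, s ∈ f.rootSet ℂ ↔ Polynomial.aeval s f = 0 := fun s =>
    Polynomial.mem_rootSet_of_ne hf
  rcases (f.rootSet ℂ).eq_empty_or_nonempty with he | hne
  · refine ⟨0, one_pos, le_rfl, fun s hs => ?_⟩
    rw [← hmem, he] at hs
    exact hs.elim
  · obtain ⟨s, hs, hmax⟩ := hfin.exists_maximalFor (fun s => ‖s‖) _ hne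
    refine ⟨‖s‖, hroot s ((hmem s).1 hs), norm_nonneg _, fun t ht => ?_⟩
    rcases le_total ‖t‖ ‖s‖ with h | h
    · exact h
    · exact hmax ((hmem t).2 ht) h

end

/-! ### Partial fractions: existence and uniqueness -/

noncomputable section

theorem sum_Icc_one_eq_sum_range {M : Type*} [AddCommMonoid M] (f : ℕ → M) (L : ℕ) :
    ∑ i ∈ Finset.Icc 1 L, f i = ∑ i ∈ Finset.range L, f (i + 1) := by
  rw [Finset.range_eq_Ico, Finset.sum_Ico_add' f 0 L 1]
  rfl

open Polynomial in
theorem pairwise_isCoprime_X_sub_C_of_field {K : Type*} [Field K] (S : Finset K) :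
    Set.Pairwise (S : Set K) fun s t => IsCoprime (X - C s) (X - C t) := fun _ _ _ _ h =>
  isCoprime_X_sub_C_of_isUnit_sub (sub_ne_zero.2 h).isUnit

open Polynomial in
/-- Partial fractions of a strictly proper fraction whose denominator is split. -/
theorem exists_partialFractions (S : Finset ℂ) (k : ℂ → ℕ) (f : ℂ[X])
    (hf : f.degree < (∏ s ∈ S, (X - C s) ^ k s).degree) :
    ∃ g : ℂ → ℕ → ℂ, (∀ s i, (s ∉ S ∨ k s < i) → g s i = 0) ∧
      ∀ z, z ∉ S → f.eval z / (∏ s ∈ S, (X - C s) ^ k s).eval z =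
        ∑ s ∈ S, ∑ i ∈ Finset.Icc 1 (k s), ((z - s) ^ i)⁻¹ * g s i := by
  classical
  set R : ℂ[X] := ∏ s ∈ S, (X - C s) ^ k s with hR
  have hRm : R.Monic := monic_prod_of_monic _ _ fun s _ => (monic_X_sub_C s).pow _
  obtain ⟨q, r, hr, hfq⟩ := eq_quo_mul_prod_pow_add_sum_rem_mul_prod_pow f
    (g := fun s : ℂ => X - C s) (fun s _ => monic_X_sub_C s) (pairwise_isCoprime_X_sub_C_of_field S) k
  -- The expansion has degree below that of `R`, so it is the remainder of f modulo `R`; strict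
  -- properness then makes the quotient q vanish.
  have hdeg : (∑ s ∈ S, ∑ j, r s j * (X - C s) ^ j.1 * ∏ t ∈ S.erase s, (X - C t) ^ k t).degree
      < R.degree := by
    have hR0 : (⊥ : WithBot ℕ) < R.degree := bot_lt_iff_ne_bot.2 (degree_ne_bot.2 hRm.ne_zero)
    refine (degree_sum_le _ _).trans_lt ((Finset.sup_lt_iff hR0).2 fun s hs => ?_)
    refine (degree_sum_le _ _).trans_lt ((Finset.sup_lt_iff hR0).2 fun j _ => ?_)
    have hEm : (∏ t ∈ S.erase s, (X - C t) ^ k t).Monic :=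
      monic_prod_of_monic _ _ fun s _ => (monic_X_sub_C s).pow _
    have hconst : (r s j).degree ≤ 0 := by
      have := hr s hs j
      rw [degree_X_sub_C] at this
      exact Nat.WithBot.lt_one_iff_le_zero.1 this
    rw [hR, ← Finset.mul_prod_erase S _ hs, mul_comm ((X - C s) ^ k s), mul_assoc,
      mul_comm ((X - C s) ^ j.1), degree_mul, degree_mul, degree_mul, degree_pow, degree_pow,
      degree_X_sub_C]
    rw [degree_eq_natDegree hEm.ne_zero]
    calc (r s j).degree + (((∏ t ∈ S.erase s, (X - C t) ^ k t).natDegree : WithBot ℕ) + j.1 • 1)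
        ≤ 0 + (((∏ t ∈ S.erase s, (X - C t) ^ k t).natDegree : WithBot ℕ) + j.1 • 1) := by gcongr
      _ < _ := by
        rw [zero_add, nsmul_one, nsmul_one]
        exact_mod_cast Nat.add_lt_add_left j.2 _
  have hq : q = 0 := by
    have h1 := (div_modByMonic_unique (f := f) q _ hRm ⟨by rw [mul_comm, add_comm]; exact hfq.symm, hdeg⟩).1
    rw [← h1, divByMonic_eq_zero_iff hRm]
    exact hf
  -- The digit at (X - s)^j contributes a pole of order k s - j, so the index is reversed.
  refine ⟨fun s i => if h : s ∈ S ∧ 1 ≤ i ∧ i ≤ k s then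
    (r s ⟨k s - i, by omega⟩).coeff 0 else 0, fun s i h => ?_, fun z hz => ?_⟩
  · refine dif_neg ?_
    rintro ⟨h1, h2, h3⟩
    rcases h with h | h
    · exact h h1
    · omega
  · have hne : ∀ s ∈ S, z - s ≠ 0 := fun s hs => sub_ne_zero.2 fun h => hz (h ▸ hs)
    rw [hfq, hq, zero_mul, zero_add, eval_finsetSum, Finset.sum_div]
    refine Finset.sum_congr rfl fun s hs => ?_
    rw [eval_finsetSum, Finset.sum_div]
    refine Finset.sum_bij' (fun j _ => k s - j.1)
      (fun i hi => ⟨k s - i, by have := Finset.mem_Icc.1 hi; omega⟩)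
      (fun j _ => Finset.mem_Icc.2 ⟨by have := j.2; omega, by omega⟩)
      (fun _ _ => Finset.mem_univ _)
      (fun j _ => Fin.ext (by have := j.2; simp only; omega))
      (fun i hi => by have := Finset.mem_Icc.1 hi; simp only; omega) fun j _ => ?_
    have hj := j.2
    have hdif : s ∈ S ∧ 1 ≤ k s - j.1 ∧ k s - j.1 ≤ k s := ⟨hs, by omega, by omega⟩
    simp only [dif_pos hdif]
    have hjj : (⟨k s - (k s - j.1), by omega⟩ : Fin (k s)) = j := Fin.ext (by simp only; omega)
    rw [hjj]
    have hconst : r s j = C ((r s j).coeff 0) := eq_C_of_degree_le_zero (by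
      have := hr s hs j
      rw [degree_X_sub_C] at this
      exact Nat.WithBot.lt_one_iff_le_zero.1 this)
    rw [hR, ← Finset.mul_prod_erase S _ hs]
    rw [eval_mul, eval_mul, eval_mul, eval_pow, eval_pow, eval_sub, eval_X, eval_C]
    have hE : eval z (∏ t ∈ S.erase s, (X - C t) ^ k t) ≠ 0 := by
      rw [eval_prod]
      refine Finset.prod_ne_zero_iff.2 fun t ht => ?_
      rw [eval_pow, eval_sub, eval_X, eval_C]
      exact pow_ne_zero _ (hne t (Finset.mem_of_mem_erase ht))
    have hpow : (z - s) ^ k s = (z - s) ^ (k s - j.1) * (z - s) ^ j.1 := by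
      rw [← pow_add]; congr 1; omega
    have h0 := hne s hs
    conv_lhs => rw [hconst, eval_C]
    rw [hpow]
    field_simp

open Polynomial in
/-- Evaluation of polynomials on the exterior of the closed unit disk. -/
def exteriorEval : ℂ[X] →+* ({z : ℂ // 1 < ‖z‖} → ℂ) :=
  RingHom.pi fun z => evalRingHom (z : ℂ)

open Polynomial in
theorem exteriorEval_apply (f : ℂ[X]) (z : {z : ℂ // 1 < ‖z‖}) :
    exteriorEval f z = f.eval (z : ℂ) := rfl

theorem infinite_exterior : {z : ℂ | 1 < ‖z‖}.Infinite := by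
  refine Set.infinite_of_injective_forall_mem (f := fun k : ℕ => ((k + 2 : ℕ) : ℂ))
    (fun a b h => ?_) fun k => ?_
  · have h' : a + 2 = b + 2 := Nat.cast_injective (R := ℂ) h
    omega
  · simp only [Set.mem_ofPred_eq, Complex.norm_natCast]
    exact_mod_cast (by omega : 1 < k + 2)

open Polynomial in
theorem exteriorEval_injective : Function.Injective exteriorEval := by
  intro f g h
  refine eq_of_infinite_eval_eq f g (infinite_exterior.mono fun z hz => ?_)
  exact congrFun h ⟨z, hz⟩

-- Polynomials embed into the functions on |z| > 1 because that set is infinite, and there each X -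
-- s is invertible. The algebraic uniqueness of partial fractions therefore applies in this function
-- ring.
open Polynomial in
theorem partialFractions_eq_zero (S : Finset ℂ) (hS : ∀ s ∈ S, ‖s‖ ≤ 1) (L : ℕ) (c₀ : ℂ)
    (c : ℂ → ℕ → ℂ) (h : ∀ z : ℂ, 1 < ‖z‖ →
      c₀ + ∑ s ∈ S, ∑ i ∈ Finset.Icc 1 L, ((z - s) ^ i)⁻¹ * c s i = 0) :
    c₀ = 0 ∧ ∀ s ∈ S, ∀ i ∈ Finset.Icc 1 L, c s i = 0 := by
  let _ : Algebra ℂ[X] ({z : ℂ // 1 < ‖z‖} → ℂ) := exteriorEval.toAlgebra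
  have hmap : ∀ f : ℂ[X], algebraMap ℂ[X] ({z : ℂ // 1 < ‖z‖} → ℂ) f = exteriorEval f :=
    fun _ => rfl
  have _ : FaithfulSMul ℂ[X] ({z : ℂ // 1 < ‖z‖} → ℂ) :=
    (faithfulSMul_iff_algebraMap_injective _ _).2 exteriorEval_injective
  have hne : ∀ s ∈ S, ∀ z : {z : ℂ // 1 < ‖z‖}, (z : ℂ) - s ≠ 0 := fun s hs z h0 => by
    have := hS s hs
    rw [← sub_eq_zero.1 h0] at this
    exact absurd z.2 (not_lt.2 this)
  obtain ⟨h1, h2⟩ := quo_add_sum_rem_mul_pow_inverse_unique (s := S)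
    (K := {z : ℂ // 1 < ‖z‖} → ℂ) (g := fun s : ℂ => X - C s)
    (fun s _ => monic_X_sub_C s) (pairwise_isCoprime_X_sub_C_of_field S) (n := fun _ => L)
    (gi := fun s z => ((z : ℂ) - s)⁻¹)
    (fun s hs => by
      funext z
      simp only [Pi.mul_apply, Pi.one_apply, hmap, exteriorEval_apply, eval_sub, eval_X, eval_C]
      exact inv_mul_cancel₀ (hne s hs z))
    (q₁ := C c₀) (q₂ := 0) (r₁ := fun s j => C (c s (j.1 + 1))) (r₂ := fun _ _ => 0)
    (fun s _ j => by
      rw [degree_X_sub_C]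
      exact degree_C_le.trans_lt (by norm_num))
    (fun s _ j => by
      rw [degree_X_sub_C, degree_zero]
      exact WithBot.bot_lt_coe 1)
    (by
      funext z
      simp only [hmap, map_zero, zero_mul, Finset.sum_const_zero, add_zero, Pi.add_apply,
        Finset.sum_apply, Pi.mul_apply, Pi.pow_apply, exteriorEval_apply, eval_C, Pi.zero_apply]
      rw [← h z z.2]
      congr 1
      refine Finset.sum_congr rfl fun s _ => ?_
      rw [sum_Icc_one_eq_sum_range, Finset.sum_range]
      exact Finset.sum_congr rfl fun i _ => by rw [mul_comm, inv_pow])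
  refine ⟨C_eq_zero.1 h1, fun s hs i hi => ?_⟩
  obtain ⟨hi1, hi2⟩ := Finset.mem_Icc.1 hi
  have := congrFun (h2 s hs) ⟨i - 1, by omega⟩
  simp only at this
  rw [C_eq_zero, Nat.sub_add_cancel hi1] at this
  exact this

end

/-! ### From rational responses to simple pole coefficients -/

noncomputable section

/-- Evaluation of a real polynomial matrix at a complex point. -/
def evalPM {a b : ℕ} (z : ℂ) (M : Matrix (Fin a) (Fin b) (Polynomial ℝ)) :
    Matrix (Fin a) (Fin b) ℂ :=
  M.map (Polynomial.aeval z)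

theorem evalPM_apply {a b : ℕ} (z : ℂ) (M : Matrix (Fin a) (Fin b) (Polynomial ℝ)) (i j) :
    evalPM z M i j = Polynomial.aeval z (M i j) := rfl

theorem evalPM_mul {a b c : ℕ} (z : ℂ) (M : Matrix (Fin a) (Fin b) (Polynomial ℝ))
    (N : Matrix (Fin b) (Fin c) (Polynomial ℝ)) :
    evalPM z (M * N) = evalPM z M * evalPM z N := by
  ext i j
  simp [evalPM_apply, Matrix.mul_apply]

theorem evalPM_add {a b : ℕ} (z : ℂ) (M N : Matrix (Fin a) (Fin b) (Polynomial ℝ)) :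
    evalPM z (M + N) = evalPM z M + evalPM z N := by
  ext i j
  simp [evalPM_apply]

theorem evalPM_sub {a b : ℕ} (z : ℂ) (M N : Matrix (Fin a) (Fin b) (Polynomial ℝ)) :
    evalPM z (M - N) = evalPM z M - evalPM z N := by
  ext i j
  simp [evalPM_apply]

theorem evalPM_smul {a b : ℕ} (z : ℂ) (f : Polynomial ℝ)
    (M : Matrix (Fin a) (Fin b) (Polynomial ℝ)) :
    evalPM z (f • M) = Polynomial.aeval z f • evalPM z M := by
  ext i j
  simp [evalPM_apply]

theorem evalPM_one {a : ℕ} (z : ℂ) :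
    evalPM z (1 : Matrix (Fin a) (Fin a) (Polynomial ℝ)) = 1 := by
  ext i j
  by_cases h : i = j <;> simp [evalPM_apply, Matrix.one_apply, h]

theorem evalPM_C {a b : ℕ} (z : ℂ) (M : Matrix (Fin a) (Fin b) ℝ) :
    evalPM z (M.map Polynomial.C) = cplx M := by
  ext i j
  simp [evalPM_apply, cplx]

theorem evalPM_charmatrix {n p q m : ℕ} (S : ControlProblem n p q m) (z : ℂ) :
    evalPM z S.A.charmatrix = S.shift z := by
  ext i j
  by_cases h : i = j <;>
    simp [evalPM_apply, ControlProblem.shift, cplx, Matrix.diagonal, h]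

theorem evalPM_conj {a b : ℕ} (z : ℂ) (M : Matrix (Fin a) (Fin b) (Polynomial ℝ)) :
    evalPM (starRingEnd ℂ z) M = (evalPM z M).map (starRingEnd ℂ) := by
  ext i j
  simp [evalPM_apply, Polynomial.aeval_conj]

namespace ControlProblem

variable {n p q m : ℕ} (S : ControlProblem n p q m)

theorem shift_eq_add (z s : ℂ) : S.shift z = (z - s) • 1 + S.shift s := by
  simp only [shift, Matrix.scalar_apply, ← Matrix.smul_one_eq_diagonal]
  module

theorem charpoly_cplx : (cplx S.A).charpoly = S.A.charpoly.map (algebraMap ℝ ℂ) :=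
  Matrix.charpoly_map S.A (algebraMap ℝ ℂ)

theorem mem_plantPoles {s : ℂ} : s ∈ S.plantPoles ↔ 1 ≤ S.mult s := by
  rw [plantPoles, Multiset.mem_toFinset, mult, ← Polynomial.count_roots,
    Nat.one_le_iff_ne_zero, Multiset.count_ne_zero]

/-- A partial fraction expansion satisfies the system level constraint outside the disk only if
its coefficients satisfy the affine coefficient constraints. -/
theorem coeff_constraints (U : Finset ℂ) (hU : ∀ s ∈ U, ‖s‖ ≤ 1) (L : ℕ) (hL : 1 ≤ L)
    (G : ℂ → ℕ → Matrix (Fin n) (Fin n) ℂ) (H : ℂ → Matrix (Fin p) (Fin n) ℂ)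
    (hG : ∀ s, G s (L + 1) = 0)
    (h : ∀ z : ℂ, 1 < ‖z‖ →
      S.shift z * (∑ s ∈ U, ∑ t ∈ Finset.Icc 1 L, ((z - s) ^ t)⁻¹ • G s t) -
        cplx S.B * (∑ s ∈ U, (z - s)⁻¹ • H s) = 1) :
    ∑ s ∈ U, G s 1 = 1 ∧ ∀ s ∈ U, ∀ t ∈ Finset.Icc 1 L,
      G s (t + 1) + S.shift s * G s t = if t = 1 then cplx S.B * H s else 0 := by
  have key : ∀ z : ℂ, 1 < ‖z‖ → (∑ s ∈ U, G s 1 - 1) +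
      ∑ s ∈ U, ∑ t ∈ Finset.Icc 1 L, ((z - s) ^ t)⁻¹ •
        (G s (t + 1) + S.shift s * G s t - if t = 1 then cplx S.B * H s else 0) = 0 := by
    intro z hz
    rw [← h z hz, Matrix.mul_sum, Matrix.mul_sum, sub_sub_eq_add_sub, sub_add_eq_add_sub,
      sub_eq_zero, ← Finset.sum_add_distrib, ← Finset.sum_add_distrib]
    refine Finset.sum_congr rfl fun s hs => ?_
    have hzs : z - s ≠ 0 := fun h0 => by
      have := hU s hs
      rw [← sub_eq_zero.1 h0] at this
      linarith
    -- Splitting zI - A = (z - s)I + (sI - A) lowers the pole order by one in the first summand.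
    have h1 : S.shift z * ∑ t ∈ Finset.Icc 1 L, ((z - s) ^ t)⁻¹ • G s t =
        ∑ t ∈ Finset.range L, ((z - s) ^ t)⁻¹ • G s (t + 1) +
          ∑ t ∈ Finset.Icc 1 L, ((z - s) ^ t)⁻¹ • (S.shift s * G s t) := by
      rw [S.shift_eq_add z s, add_mul, Matrix.mul_sum, Matrix.mul_sum]
      congr 1
      · rw [sum_Icc_one_eq_sum_range]
        refine Finset.sum_congr rfl fun t _ => ?_
        rw [smul_mul_smul_comm, one_mul, pow_succ]
        congr 1
        field_simp
      · exact Finset.sum_congr rfl fun t _ => Matrix.mul_smul _ _ _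
    -- Peeling the sum over `range (L + 1)` from either end shifts the index; the top term is zero
    -- because G s (L + 1) = 0.
    have h2 : ∑ t ∈ Finset.range L, ((z - s) ^ t)⁻¹ • G s (t + 1) =
        G s 1 + ∑ t ∈ Finset.Icc 1 L, ((z - s) ^ t)⁻¹ • G s (t + 1) := by
      have e1 := Finset.sum_range_succ (fun t => ((z - s) ^ t)⁻¹ • G s (t + 1)) L
      have e2 := Finset.sum_range_succ' (fun t => ((z - s) ^ t)⁻¹ • G s (t + 1)) L
      rw [hG, smul_zero, add_zero] at e1
      rw [← e1, e2, sum_Icc_one_eq_sum_range, pow_zero, inv_one, one_smul, zero_add, add_comm]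
    have h3 : ∑ t ∈ Finset.Icc 1 L, ((z - s) ^ t)⁻¹ • (if t = 1 then cplx S.B * H s else 0) =
        cplx S.B * ((z - s)⁻¹ • H s) := by
      rw [Finset.sum_eq_single_of_mem 1 (Finset.mem_Icc.2 ⟨le_rfl, hL⟩)
        (fun t _ ht => by rw [if_neg ht, smul_zero]), if_pos rfl, pow_one, Matrix.mul_smul]
    simp only [smul_sub, smul_add, Finset.sum_sub_distrib, Finset.sum_add_distrib]
    rw [h1, h2, h3]
    abel
  have hscal : ∀ i j, _ := fun i j => partialFractions_eq_zero U hU L ((∑ s ∈ U, G s 1 - 1) i j)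
    (fun s t => (G s (t + 1) + S.shift s * G s t - if t = 1 then cplx S.B * H s else 0) i j)
    (fun z hz => by
      have := congrFun (congrFun (key z hz) i) j
      simpa only [Matrix.add_apply, Matrix.sum_apply, Matrix.smul_apply, smul_eq_mul,
        Matrix.zero_apply] using this)
  refine ⟨sub_eq_zero.1 (Matrix.ext fun i j => (hscal i j).1), fun s hs t ht => ?_⟩
  exact sub_eq_zero.1 (Matrix.ext fun i j => (hscal i j).2 s hs t ht)

open Polynomial in
/-- Transfer functions with polynomial numerators, simple poles in `P` and stable plant poles which
satisfy the system level constraint are simple pole approximations. -/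
theorem exists_spaCoeffs (P P' : Finset ℂ) (hP : ∀ s ∈ P, ‖s‖ < 1) (hP' : P' ⊆ P)
    (d a : ℝ[X]) (hd : d.map (algebraMap ℝ ℂ) = ∏ s ∈ P', (X - Polynomial.C s)) (ha : a.Monic)
    (hadvd : a ∣ S.A.charpoly) (hastab : ∀ s : ℂ, aeval s a = 0 → ‖s‖ < 1)
    (M : Matrix (Fin n) (Fin n) ℝ[X]) (N : Matrix (Fin p) (Fin n) ℝ[X])
    (hM : ∀ i j, (M i j).degree < (a * d).degree) (hN : ∀ i j, (N i j).degree < d.degree)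
    (heq : S.A.charmatrix * M - a • (S.B.map Polynomial.C * N) = (a * d) • 1) :
    ∃ c : SPACoeffs n p, S.SPAFeasible P c ∧ ∀ z : ℂ, 1 < ‖z‖ →
      S.spaX P c z = (aeval z (a * d))⁻¹ • evalPM z M ∧
      spaU P c z = (aeval z d)⁻¹ • evalPM z N := by
  classical
  have hdm' : (d.map (algebraMap ℝ ℂ)).Monic := by
    rw [hd]; exact monic_prod_of_monic _ _ fun s _ => monic_X_sub_C s
  have hdm : d.Monic := monic_of_injective (algebraMap ℝ ℂ).injective hdm'
  set R : ℂ[X] := (a * d).map (algebraMap ℝ ℂ) with hR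
  have hRm : R.Monic := (ha.mul hdm).map _
  have hR0 : R ≠ 0 := hRm.ne_zero
  have hRmul : R = a.map (algebraMap ℝ ℂ) * d.map (algebraMap ℝ ℂ) := Polynomial.map_mul _
  set κ : ℂ → ℕ := fun s => R.rootMultiplicity s with hκ
  set U : Finset ℂ := R.roots.toFinset with hU
  have hmemU : ∀ s, s ∈ U ↔ R.eval s = 0 := fun s => by
    rw [hU, Multiset.mem_toFinset, mem_roots hR0, IsRoot.def]
  have hprod : ∏ s ∈ U, (X - Polynomial.C s) ^ κ s = R := by
    conv_rhs => rw [(IsAlgClosed.splits R).eq_prod_roots_of_monic hRm]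
    rw [Finset.prod_multiset_map_count]
    exact Finset.prod_congr rfl fun s _ => by rw [count_roots]
  have haeval : ∀ (f : ℝ[X]) (z : ℂ), (f.map (algebraMap ℝ ℂ)).eval z = aeval z f := fun f z => by
    rw [eval_map, aeval_def]
  have hdeval : ∀ s, aeval s d = 0 ↔ s ∈ P' := fun s => by
    rw [← haeval, hd, eval_prod, Finset.prod_eq_zero_iff]
    simp only [eval_sub, eval_X, eval_C, sub_eq_zero]
    exact ⟨fun ⟨t, ht, h⟩ => h ▸ ht, fun h => ⟨s, h, rfl⟩⟩
  have hP'U : P' ⊆ U := fun s hs => by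
    rw [hmemU, hRmul, eval_mul, haeval d, (hdeval s).2 hs, mul_zero]
  have hU1 : ∀ s ∈ U, ‖s‖ < 1 := fun s hs => by
    rw [hmemU, hRmul, eval_mul, mul_eq_zero, haeval, haeval, hdeval] at hs
    exact hs.elim (hastab s) fun h => hP s (hP' h)
  have hκ0 : ∀ s, s ∉ U → κ s = 0 := fun s hs => rootMultiplicity_eq_zero (by
    rwa [IsRoot.def, ← hmemU])
  -- The factor a contributes at most the multiplicity in the characteristic polynomial, and d, with
  -- simple roots inside P, at most `mtilde P s`.
  have hκle : ∀ s, κ s ≤ S.mult s + mtilde P s := fun s => by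
    have h1 : κ s = (a.map (algebraMap ℝ ℂ)).rootMultiplicity s +
        (d.map (algebraMap ℝ ℂ)).rootMultiplicity s := by
      rw [hκ, ← rootMultiplicity_mul (by rw [← hRmul]; exact hR0), ← hRmul]
    rw [h1]
    refine add_le_add ?_ ?_
    · rw [mult, S.charpoly_cplx]
      exact rootMultiplicity_le_rootMultiplicity_of_dvd
        ((Matrix.charpoly_monic _).map _).ne_zero (Polynomial.map_dvd _ hadvd) s
    · rw [hd, ← count_roots, roots_prod_X_sub_C]
      rw [mtilde]
      split_ifs with hs
      · exact Multiset.nodup_iff_count_le_one.1 P'.nodup s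
      · rw [Multiset.count_eq_zero_of_notMem fun h => hs (hP' h)]
  -- A uniform length exceeding every pole order, so that all expansions can be padded with zeros.
  set L : ℕ := R.natDegree + 1 with hL
  have hκL : ∀ s, κ s < L := fun s => Nat.lt_succ_of_le (by
    rw [hκ]; simp only
    rw [← count_roots]
    exact (Multiset.count_le_card _ _).trans (card_roots' R))
  have hmapdeg : ∀ f : ℝ[X], (f.map (algebraMap ℝ ℂ)).degree = f.degree := fun f =>
    degree_map f _
  choose gM hgM0 hgM using fun i j => exists_partialFractions U κ
    ((M i j).map (algebraMap ℝ ℂ)) (by rw [hprod, hmapdeg, hR, hmapdeg]; exact hM i j)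
  have hd1 : ∏ s ∈ P', (X - Polynomial.C s) ^ (1 : ℕ) = d.map (algebraMap ℝ ℂ) := by
    simp only [pow_one]; exact hd.symm
  choose gN hgN0 hgN using fun i j => exists_partialFractions P' (fun _ => 1)
    ((N i j).map (algebraMap ℝ ℂ)) (by rw [hd1, hmapdeg, hmapdeg]; exact hN i j)
  set G : ℂ → ℕ → Matrix (Fin n) (Fin n) ℂ := fun s t => Matrix.of fun i j => gM i j s t with hG
  set H : ℂ → Matrix (Fin p) (Fin n) ℂ := fun s => Matrix.of fun i j => gN i j s 1 with hH
  have hGU : ∀ s t, s ∉ U → G s t = 0 := fun s t h =>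
    Matrix.ext fun i j => hgM0 i j s t (Or.inl h)
  have hGκ : ∀ s t, κ s < t → G s t = 0 := fun s t h =>
    Matrix.ext fun i j => hgM0 i j s t (Or.inr h)
  have hHP : ∀ s, s ∉ P' → H s = 0 := fun s h =>
    Matrix.ext fun i j => hgN0 i j s 1 (Or.inl h)
  have hXk : ∀ (z : ℂ) (s : ℂ) (l : ℕ), κ s ≤ l →
      ∑ t ∈ Finset.Icc 1 (κ s), ((z - s) ^ t)⁻¹ • G s t =
        ∑ t ∈ Finset.Icc 1 l, ((z - s) ^ t)⁻¹ • G s t := fun z s l hl => by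
    refine Finset.sum_subset (Finset.Icc_subset_Icc_right hl) fun t ht ht' => ?_
    rw [hGκ s t (by
      rw [Finset.mem_Icc] at ht ht'
      omega), smul_zero]
  have hzU : ∀ z : ℂ, 1 < ‖z‖ → z ∉ U := fun z hz h => by
    have := hU1 z h
    linarith
  have hX : ∀ z : ℂ, 1 < ‖z‖ → (aeval z (a * d))⁻¹ • evalPM z M =
      ∑ s ∈ U, ∑ t ∈ Finset.Icc 1 (κ s), ((z - s) ^ t)⁻¹ • G s t := fun z hz => by
    ext i j
    have := hgM i j z (hzU z hz)
    rw [hprod, haeval, hR, haeval, div_eq_inv_mul] at this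
    simpa only [Matrix.smul_apply, evalPM_apply, smul_eq_mul, Matrix.sum_apply, hG,
      Matrix.of_apply] using this
  have hV : ∀ z : ℂ, 1 < ‖z‖ → (aeval z d)⁻¹ • evalPM z N = ∑ s ∈ P', (z - s)⁻¹ • H s :=
    fun z hz => by
    ext i j
    have := hgN i j z (fun h => hzU z hz (hP'U h))
    rw [hd1, haeval, haeval, div_eq_inv_mul] at this
    simpa only [Matrix.smul_apply, evalPM_apply, smul_eq_mul, Matrix.sum_apply, Finset.Icc_self, hH, Matrix.of_apply,
      Finset.sum_singleton, pow_one] using this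
  have hne : ∀ z : ℂ, 1 < ‖z‖ → aeval z a ≠ 0 ∧ aeval z d ≠ 0 := fun z hz => by
    have := hzU z hz
    rw [hmemU, hRmul, eval_mul, haeval, haeval] at this
    exact ⟨left_ne_zero_of_mul this, right_ne_zero_of_mul this⟩
  obtain ⟨hsum, hcoef⟩ := S.coeff_constraints U (fun s hs => (hU1 s hs).le) L (by omega) G H
    (fun s => hGκ s _ ((hκL s).trans (Nat.lt_succ_self _))) (fun z hz => by
      obtain ⟨hza, hzd⟩ := hne z hz
      have e1 : ∑ s ∈ U, ∑ t ∈ Finset.Icc 1 L, ((z - s) ^ t)⁻¹ • G s t =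
          (aeval z (a * d))⁻¹ • evalPM z M := by
        rw [hX z hz]
        exact Finset.sum_congr rfl fun s _ => (hXk z s L (hκL s).le).symm
      have e2 : ∑ s ∈ U, (z - s)⁻¹ • H s = (aeval z d)⁻¹ • evalPM z N := by
        rw [hV z hz]
        exact (Finset.sum_subset hP'U fun s _ hs => by rw [hHP s hs, smul_zero]).symm
      have e3 := congrArg (evalPM z) heq
      rw [evalPM_sub, evalPM_mul, evalPM_smul, evalPM_mul, evalPM_smul, evalPM_one, evalPM_C,
        evalPM_charmatrix] at e3
      rw [e1, e2, Matrix.mul_smul, Matrix.mul_smul]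
      have e4 : (aeval z d)⁻¹ • (cplx S.B * evalPM z N) =
          (aeval z (a * d))⁻¹ • (aeval z a • (cplx S.B * evalPM z N)) := by
        rw [smul_smul, map_mul, mul_inv, mul_right_comm, inv_mul_cancel₀ hza, one_mul]
      rw [e4, ← smul_sub, e3, smul_smul, inv_mul_cancel₀, one_smul]
      rw [map_mul]
      exact mul_ne_zero hza hzd)
  -- One recursion, valid at every point and every order; the chain, last and pole equations of the
  -- ansatz are its special cases.
  have hE : ∀ s t, 1 ≤ t →
      G s (t + 1) + S.shift s * G s t = if t = 1 then cplx S.B * H s else 0 := fun s t ht => by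
    by_cases hs : s ∈ U
    · by_cases htL : t ≤ L
      · exact hcoef s hs t (Finset.mem_Icc.2 ⟨ht, htL⟩)
      · have := hκL s
        rw [hGκ s _ (by omega), hGκ s t (by omega), mul_zero, add_zero, if_neg (by omega)]
    · rw [hGU s _ hs, hGU s _ hs, mul_zero, add_zero, hHP s fun h => hs (hP'U h), Matrix.mul_zero,
        ite_self]
  have hUsub : U ⊆ P \ S.plantPoles ∪ S.plantPoles := fun s hs => by
    rw [Finset.sdiff_union_self_eq_union, Finset.mem_union, S.mem_plantPoles]
    by_contra hcon
    push Not at hcon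
    have h1 := hκle s
    rw [mtilde, if_neg hcon.1] at h1
    have h2 : κ s ≠ 0 := (rootMultiplicity_pos hR0).2 ((hmemU s).1 hs) |>.ne'
    omega
  have hdisj : Disjoint (P \ S.plantPoles) S.plantPoles := Finset.sdiff_disjoint
  have hκsimple : ∀ s ∈ P \ S.plantPoles, κ s ≤ 1 := fun s hs => by
    rw [Finset.mem_sdiff, S.mem_plantPoles] at hs
    have h1 := hκle s
    have h2 : mtilde P s ≤ 1 := by rw [mtilde]; split_ifs <;> omega
    omega
  have hsplit : ∀ f : ℂ → Matrix (Fin n) (Fin n) ℂ, (∀ s, s ∉ U → f s = 0) →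
      ∑ s ∈ P \ S.plantPoles, f s + ∑ s ∈ S.plantPoles, f s = ∑ s ∈ U, f s := fun f hf => by
    rw [← Finset.sum_union hdisj]
    exact (Finset.sum_subset hUsub fun s _ hs => hf s hs).symm
  set c : SPACoeffs n p := ⟨H, fun s => G s 1, G⟩ with hc
  have hspaX : ∀ z : ℂ, 1 < ‖z‖ → S.spaX P c z = (aeval z (a * d))⁻¹ • evalPM z M := fun z hz => by
    rw [hX z hz, ← hsplit _ fun s hs => by rw [hκ0 s hs]; rfl, spaX]
    refine congrArg₂ (· + ·) (Finset.sum_congr rfl fun s hs => ?_)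
      (Finset.sum_congr rfl fun s hs => ?_)
    · rw [hXk z s 1 (hκsimple s hs), Finset.Icc_self, Finset.sum_singleton, pow_one]
    · refine (hXk z s _ ((hκle s).trans (Nat.add_le_add_left ?_ _))).symm
      rw [mtilde]; split_ifs <;> omega
  have hspaU : ∀ z : ℂ, 1 < ‖z‖ → spaU P c z = (aeval z d)⁻¹ • evalPM z N := fun z hz => by
    rw [hV z hz, spaU]
    exact (Finset.sum_subset hP' fun s _ hs => by
      rw [show c.H s = 0 from hHP s hs, smul_zero]).symm
  refine ⟨c, ⟨fun s hs => ?_, fun s hs => ?_, fun s hs i hi => ?_, fun s hs => ?_, ?_,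
    fun s hs hs1 i _ => hGU s i fun h => absurd (hU1 s h) (not_lt.2 hs1), fun z hz => ?_,
    fun z hz => ?_⟩, fun z hz => ⟨hspaX z hz, hspaU z hz⟩⟩
  · have := hE s 1 le_rfl
    rw [if_pos rfl] at this
    exact sub_eq_zero.2 this
  · have := hE s 1 le_rfl
    rw [if_pos rfl, hGκ s 2 (Nat.lt_succ_of_le (hκsimple s hs)), zero_add] at this
    exact sub_eq_zero.2 this
  · rw [Finset.mem_Icc] at hi
    rw [hE s i (by omega)]
    -- Order 1 lies in this range only when `mtilde P s = 0`, so s is not a selected pole and H s =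
    -- 0.
    split_ifs with hi1
    · have hsP : s ∉ P := fun h => by
        rw [mtilde, if_pos h] at hi
        omega
      rw [hHP s fun h => hsP (hP' h), Matrix.mul_zero]
    · rfl
  · have hms := S.mem_plantPoles.1 hs
    have := hE s (S.mult s + mtilde P s) (by omega)
    rw [hGκ s _ (Nat.lt_succ_of_le (hκle s)), zero_add] at this
    refine this.trans ?_
    split_ifs with hi1
    · have hsP : s ∉ P := fun h => by
        rw [mtilde, if_pos h] at hi1
        omega
      rw [hHP s fun h => hsP (hP' h), Matrix.mul_zero]
    · rfl
  · rw [← hsum]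
    exact hsplit (fun s => G s 1) fun s hs => hGU s 1 hs
  · rw [hspaU z hz, hspaU _ (by rwa [RCLike.norm_conj]), evalPM_conj, aeval_conj]
    ext i j
    simp
  · rw [hspaX z hz, hspaX _ (by rwa [RCLike.norm_conj]), evalPM_conj, aeval_conj]
    ext i j
    simp

end ControlProblem

end

/-! ### Restoring the constraint after a change of denominator -/

noncomputable section

open Polynomial

/-- Every monic polynomial is a product of a factor coprime to `d` and a factor all of whose roots
are roots of `d`. -/
theorem exists_coprime_factorization (d : ℝ[X]) (a : ℝ[X]) (ha : a.Monic) :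
    ∃ a₁ a₂ : ℝ[X], a₁.Monic ∧ a₂.Monic ∧ a₁ * a₂ = a ∧ (∃ k, a₁ ∣ d ^ k) ∧ IsCoprime a₂ d := by
  have key : ∀ l : ℕ, ∀ a : ℝ[X], a ≠ 0 → a.natDegree ≤ l →
      ∃ a₁ a₂ : ℝ[X], a₁ * a₂ = a ∧ (∃ k, a₁ ∣ d ^ k) ∧ IsCoprime a₂ d := by
    intro l
    induction l with
    | zero =>
      intro a ha hl
      refine ⟨1, a, one_mul a, ⟨0, one_dvd _⟩, ?_⟩
      rw [eq_C_of_natDegree_le_zero hl] at ha ⊢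
      refine ⟨C (a.coeff 0)⁻¹, 0, ?_⟩
      rw [zero_mul, add_zero, ← C_mul, inv_mul_cancel₀ (C_ne_zero.1 ha), C_1]
    | succ l ih =>
      intro a ha hl
      by_cases hc : IsCoprime a d
      · exact ⟨1, a, one_mul a, ⟨0, one_dvd _⟩, hc⟩
      · set g := EuclideanDomain.gcd a d with hg
        have hgu : ¬ IsUnit g := fun h => hc (EuclideanDomain.gcd_isUnit_iff.1 h)
        obtain ⟨b, hb⟩ : g ∣ a := EuclideanDomain.gcd_dvd_left a d
        have hg0 : g ≠ 0 := fun h => ha (by rw [hb, h, zero_mul])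
        have hb0 : b ≠ 0 := fun h => ha (by rw [hb, h, mul_zero])
        have hgd : 0 < g.natDegree := natDegree_pos_iff_degree_pos.2
          (degree_pos_of_ne_zero_of_nonunit hg0 hgu)
        obtain ⟨a₁, a₂, h1, ⟨k, hk⟩, h3⟩ := ih b hb0 (by
          rw [hb, natDegree_mul hg0 hb0] at hl
          omega)
        refine ⟨g * a₁, a₂, by rw [mul_assoc, h1, ← hb], ⟨k + 1, ?_⟩, h3⟩
        rw [pow_succ']
        exact mul_dvd_mul (EuclideanDomain.gcd_dvd_right a d) hk
  obtain ⟨a₁, a₂, h1, ⟨k, hk⟩, h3⟩ := key _ a ha.ne_zero le_rfl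
  have hlc : a₁.leadingCoeff * a₂.leadingCoeff = 1 := by
    rw [← leadingCoeff_mul, h1]; exact ha
  have hu1 : a₁.leadingCoeff ≠ 0 := left_ne_zero_of_mul (hlc.symm ▸ one_ne_zero)
  have hu2 : a₂.leadingCoeff ≠ 0 := right_ne_zero_of_mul (hlc.symm ▸ one_ne_zero)
  -- The leading coefficients are mutually inverse, so exchanging them makes both factors monic
  -- without changing the product.
  refine ⟨C a₂.leadingCoeff * a₁, C a₁.leadingCoeff * a₂, ?_, ?_, ?_, ⟨k, ?_⟩, ?_⟩
  · rw [Monic, leadingCoeff_mul, leadingCoeff_C, mul_comm, hlc]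
  · rw [Monic, leadingCoeff_mul, leadingCoeff_C, hlc]
  · rw [mul_mul_mul_comm, ← C_mul, mul_comm a₂.leadingCoeff, hlc, C_1, one_mul, h1]
  · exact (isUnit_C.2 hu2.isUnit).mul_left_dvd.2 hk
  · exact (isCoprime_mul_unit_left_left (isUnit_C.2 hu1.isUnit) _ _).2 h3

theorem natDegree_matrix_mul_le {a b c : ℕ} {M : Matrix (Fin a) (Fin b) ℝ[X]}
    {N : Matrix (Fin b) (Fin c) ℝ[X]} {k l : ℕ} (hM : ∀ i j, (M i j).natDegree ≤ k)
    (hN : ∀ i j, (N i j).natDegree ≤ l) (i j) : ((M * N) i j).natDegree ≤ k + l := by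
  rw [Matrix.mul_apply]
  exact natDegree_sum_le_of_forall_le _ _ fun t _ =>
    natDegree_mul_le_of_le (hM i t) (hN t j)

theorem natDegree_matrix_C_le {a b : ℕ} (M : Matrix (Fin a) (Fin b) ℝ) (i j) :
    (M.map C i j).natDegree ≤ 0 := by
  rw [Matrix.map_apply, natDegree_C]

theorem natDegree_det_le_of_natDegree_le_one {n : ℕ} (M : Matrix (Fin n) (Fin n) ℝ[X])
    (hM : ∀ i j, (M i j).natDegree ≤ 1) : M.det.natDegree ≤ n := by
  rw [Matrix.det_apply']
  refine natDegree_sum_le_of_forall_le _ _ fun σ _ => ?_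
  refine (natDegree_mul_le_of_le (natDegree_intCast _).le
    ((natDegree_prod_le _ _).trans (Finset.sum_le_sum fun i _ => hM _ _))).trans ?_
  simp

theorem natDegree_adjugate_charmatrix_le {n : ℕ} (A : Matrix (Fin n) (Fin n) ℝ) (i j) :
    (A.charmatrix.adjugate i j).natDegree ≤ n := by
  rw [Matrix.adjugate_apply]
  refine natDegree_det_le_of_natDegree_le_one _ fun k l => ?_
  rw [Matrix.updateRow_apply]
  split_ifs
  · rw [Pi.single_apply]
    split_ifs <;> simp
  · exact (Matrix.charmatrix_apply_natDegree_le _ _).trans (by split_ifs <;> omega)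

/-- Correction of a numerator matrix which restores the interpolation conditions at the roots of
`a₂` after the denominator `d` has been changed by `X ^ j`. -/
theorem exists_numerator_correction {p n : ℕ} {d a₂ : ℝ[X]} (ha₂ : a₂.Monic)
    (hc : IsCoprime a₂ d) (hdeg : a₂.natDegree + 2 ≤ d.natDegree)
    (N : Matrix (Fin p) (Fin n) ℝ[X]) (hN : ∀ i j, (N i j).degree < d.degree)
    (j : ℕ) (hj : j < d.natDegree) :
    ∃ E F : Matrix (Fin p) (Fin n) ℝ[X], a₂ • F = d • E - (X ^ j : ℝ[X]) • N ∧
      (∀ i l, (E i l).natDegree ≤ a₂.natDegree) ∧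
      ∀ i l, (F i l).natDegree + a₂.natDegree ≤ 2 * d.natDegree - 2 := by
  -- From u a₂ + w d = 1, the residue E of w X^j N modulo a₂ satisfies d E ≡ X^j N. Reducing modulo
  -- a₂ keeps the degree of E small.
  obtain ⟨u, w, huw⟩ := hc
  set E : Matrix (Fin p) (Fin n) ℝ[X] := Matrix.of fun i l => (w * (X ^ j * N i l)) %ₘ a₂ with hE
  set F : Matrix (Fin p) (Fin n) ℝ[X] := Matrix.of fun i l =>
    -(u * (X ^ j * N i l) + d * ((w * (X ^ j * N i l)) /ₘ a₂)) with hF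
  have hEF : ∀ i l, a₂ * F i l = d * E i l - X ^ j * N i l := fun i l => by
    have h := modByMonic_add_div (w * (X ^ j * N i l)) a₂
    simp only [hE, hF, Matrix.of_apply]
    linear_combination (-d) * h - (X ^ j * N i l) * huw
  have hEdeg : ∀ i l, (E i l).natDegree ≤ a₂.natDegree := fun i l =>
    natDegree_le_natDegree (degree_modByMonic_lt _ ha₂).le
  refine ⟨E, F, Matrix.ext fun i l => hEF i l, hEdeg, fun i l => ?_⟩
  by_cases hF0 : F i l = 0
  · rw [hF0, natDegree_zero]; omega
  · rw [add_comm, ← ha₂.natDegree_mul' hF0, hEF]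
    refine (natDegree_sub_le _ _).trans (max_le ?_ ?_)
    · exact (natDegree_mul_le_of_le le_rfl (hEdeg i l)).trans (by omega)
    · have hNil : (N i l).natDegree ≤ d.natDegree - 1 := by
        by_cases h0 : N i l = 0
        · rw [h0, natDegree_zero]; omega
        · have := natDegree_lt_natDegree h0 (hN i l)
          omega
      exact (natDegree_mul_le_of_le (natDegree_X_pow_le j) hNil).trans (by omega)

/-- The state response belonging to a corrected numerator matrix of the input response. -/
theorem exists_state_numerator {n p : ℕ} (A : Matrix (Fin n) (Fin n) ℝ)
    (B : Matrix (Fin n) (Fin p) ℝ) {d e a₁ a₂ : ℝ[X]} (hd : d.Monic)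
    (ha₁ : a₁.Monic) (ha : a₁ * a₂ = A.charpoly) (hc : IsCoprime a₂ d)
    (M : Matrix (Fin n) (Fin n) ℝ[X]) (N E F : Matrix (Fin p) (Fin n) ℝ[X])
    (heq : A.charmatrix * M - B.map C * N = d • 1) (hF : a₂ • F = d • E - e • N) :
    ∃ M' : Matrix (Fin n) (Fin n) ℝ[X],
      d • M' = (a₁ * (d + e)) • M + A.charmatrix.adjugate * (B.map C * F) ∧
      A.charmatrix * M' - a₁ • (B.map C * (N + E)) = (a₁ * (d + e)) • 1 := by
  set Bm : Matrix (Fin n) (Fin p) ℝ[X] := B.map C with hB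
  set W : Matrix (Fin n) (Fin n) ℝ[X] :=
    (a₁ * (d + e)) • M + A.charmatrix.adjugate * (Bm * F) with hW
  have hM : A.charmatrix * M = d • 1 + Bm * N := by rw [← heq, sub_add_cancel]
  have hdet : A.charmatrix.det = a₁ * a₂ := ha.symm
  have hBF : a₂ • (Bm * F) = d • (Bm * E) - e • (Bm * N) := by
    rw [← Matrix.mul_smul, hF, Matrix.mul_sub, Matrix.mul_smul, Matrix.mul_smul]
  have hAW : A.charmatrix * W = d • (a₁ • (Bm * (N + E)) + (a₁ * (d + e)) • 1) := by
    rw [hW, Matrix.mul_add, Matrix.mul_smul, hM, ← Matrix.mul_assoc, Matrix.mul_adjugate, hdet,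
      smul_mul_assoc, one_mul, mul_smul a₁ a₂, hBF, Matrix.mul_add]
    module
  -- Multiplying by the adjugate gives a₁a₂W as a multiple of a₁d. Cancelling a₁ and using that a₂
  -- is coprime to d leaves d ∣ W.
  have hdvd : ∀ i j, d ∣ W i j := fun i j => by
    have h1 : a₂ • W = d • (A.charmatrix.adjugate * (Bm * (N + E) + (d + e) • 1)) := by
      have h2 : a₁ • (a₂ • W) =
          a₁ • (d • (A.charmatrix.adjugate * (Bm * (N + E) + (d + e) • 1))) := by
        rw [smul_smul, ← hdet, ← one_mul W, ← smul_mul_assoc, ← Matrix.adjugate_mul,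
          Matrix.mul_assoc, hAW, mul_smul a₁ (d + e), ← smul_add, Matrix.mul_smul,
          Matrix.mul_smul, smul_comm]
      exact Matrix.ext fun i j =>
        mul_left_cancel₀ ha₁.ne_zero (congrFun (congrFun h2 i) j)
    refine hc.symm.dvd_of_dvd_mul_left ⟨_, congrFun (congrFun h1 i) j⟩
  choose M' hM' using hdvd
  have hMW : d • Matrix.of M' = W := Matrix.ext fun i j => (hM' i j).symm
  refine ⟨Matrix.of M', hMW, ?_⟩
  have h3 : d • (A.charmatrix * Matrix.of M') =
      d • (a₁ • (Bm * (N + E)) + (a₁ * (d + e)) • 1) := by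
    rw [← Matrix.mul_smul, hMW, hAW]
  rw [sub_eq_iff_eq_add, add_comm]
  exact Matrix.ext fun i j => mul_left_cancel₀ hd.ne_zero (congrFun (congrFun h3 i) j)

end

/-! ### Continuity of the objective under uniform entrywise perturbation -/

noncomputable section

theorem frobSq_rpow_le_add {a b : ℕ} (M M' : Matrix (Fin a) (Fin b) ℂ) {ε : ℝ} (hε : 0 ≤ ε)
    (h : ∀ i j, ‖M' i j - M i j‖ ≤ ε) :
    frobSq M' ^ (1 / 2 : ℝ) ≤ frobSq M ^ (1 / 2 : ℝ) + ENNReal.ofReal (a * b * ε) := by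
  have hsum : ∀ N : Matrix (Fin a) (Fin b) ℂ, frobSq N =
      ∑ x : Fin a × Fin b, ‖N x.1 x.2‖ₑ ^ (2 : ℝ) := fun N => by
    simp only [ENNReal.rpow_ofNat, frobSq, Fintype.sum_prod_type]
  have h1 : frobSq M' ≤ ∑ x : Fin a × Fin b, (‖M x.1 x.2‖ₑ + ‖M' x.1 x.2 - M x.1 x.2‖ₑ) ^ (2 : ℝ) := by
    rw [hsum]
    refine Finset.sum_le_sum fun x _ => ENNReal.rpow_le_rpow ?_ two_pos.le
    calc ‖M' x.1 x.2‖ₑ = ‖M x.1 x.2 + (M' x.1 x.2 - M x.1 x.2)‖ₑ := by rw [add_sub_cancel]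
      _ ≤ _ := enorm_add_le _ _
  refine (ENNReal.rpow_le_rpow h1 (by norm_num)).trans
    ((ENNReal.Lp_add_le _ _ _ one_le_two).trans ?_)
  rw [← hsum]
  gcongr
  have h2 : ∑ x : Fin a × Fin b, ‖M' x.1 x.2 - M x.1 x.2‖ₑ ^ (2 : ℝ) ≤
      ENNReal.ofReal (a * b * ε) ^ (2 : ℝ) := by
    calc ∑ x : Fin a × Fin b, ‖M' x.1 x.2 - M x.1 x.2‖ₑ ^ (2 : ℝ)
        ≤ ∑ _x : Fin a × Fin b, ENNReal.ofReal (ε ^ 2) := by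
          refine Finset.sum_le_sum fun x _ => ?_
          rw [ENNReal.rpow_ofNat, ENNReal.ofReal_pow hε]
          gcongr
          rw [← ofReal_norm]
          exact ENNReal.ofReal_le_ofReal (h _ _)
      _ = ENNReal.ofReal ((a * b : ℕ) * ε ^ 2) := by
          rw [Finset.sum_const, Finset.card_univ, Fintype.card_prod, Fintype.card_fin,
            Fintype.card_fin, nsmul_eq_mul, ENNReal.ofReal_mul (by positivity),
            ENNReal.ofReal_natCast]
      _ ≤ ENNReal.ofReal (a * b * ε) ^ (2 : ℝ) := by
          rw [ENNReal.rpow_ofNat, ← ENNReal.ofReal_pow (by positivity)]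
          refine ENNReal.ofReal_le_ofReal ?_
          -- The crude bound √(ab) ≤ ab, valid for natural numbers, avoids a square root in the
          -- constant.
          have h3 : ((a * b : ℕ) : ℝ) ≤ (a * b : ℕ) ^ 2 := by
            exact_mod_cast Nat.le_self_pow two_ne_zero _
          push_cast at h3 ⊢
          rw [mul_pow]
          exact mul_le_mul_of_nonneg_right h3 (sq_nonneg _)
  refine (ENNReal.rpow_le_rpow h2 (by norm_num)).trans ?_
  rw [← ENNReal.rpow_mul]
  norm_num

/-- Minkowski's inequality on each circle for the probability measure dθ/2π. The difference is
replaced by a constant before integrating, so only T has to be measurable. -/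
theorem normH2_le_add {a b : ℕ} (T T' : ℂ → Matrix (Fin a) (Fin b) ℂ) {ε : ℝ} (hε : 0 ≤ ε)
    (hT : ∀ i j, ContinuousOn (fun z => T z i j) {z : ℂ | 1 < ‖z‖})
    (h : ∀ z : ℂ, 1 < ‖z‖ → ∀ i j, ‖T' z i j - T z i j‖ ≤ ε) :
    normH2 T' ≤ normH2 T + ENNReal.ofReal (a * b * ε) := by
  refine iSup₂_le fun r hr => ?_
  refine le_trans ?_ (add_le_add_left (le_iSup₂ (f := fun (r : ℝ) (_ : 1 < r) =>
    (ENNReal.ofReal (1 / (2 * Real.pi)) * ∫⁻ θ in Set.Ioc (0 : ℝ) (2 * Real.pi),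
      frobSq (T ((r : ℂ) * Complex.exp ((θ : ℂ) * Complex.I)))) ^ (1 / 2 : ℝ)) r hr) _)
  set ζ : ℝ → ℂ := fun θ => (r : ℂ) * Complex.exp ((θ : ℂ) * Complex.I) with hζ
  have hζ1 : ∀ θ, 1 < ‖ζ θ‖ := fun θ => by
    rw [hζ]
    simp only
    rw [norm_mul, Complex.norm_exp_ofReal_mul_I, mul_one, Complex.norm_real]
    exact hr.trans_le (Real.le_norm_self r)
  have hζc : Continuous ζ := by fun_prop
  have hmeas : Measurable fun θ => frobSq (T (ζ θ)) ^ (1 / 2 : ℝ) := by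
    refine Measurable.pow_const (Finset.measurable_sum _ fun i _ =>
      Finset.measurable_sum _ fun j _ => Measurable.pow_const (Measurable.enorm ?_) 2) _
    exact ((hT i j).comp_continuous hζc hζ1).measurable
  have hsq : ∀ x : ℝ≥0∞, (x ^ (1 / 2 : ℝ)) ^ (2 : ℝ) = x := fun x => by
    rw [← ENNReal.rpow_mul]; norm_num
  set μ := MeasureTheory.volume.restrict (Set.Ioc (0 : ℝ) (2 * Real.pi)) with hμ
  set e : ℝ≥0∞ := ENNReal.ofReal (a * b * ε) with he
  set c : ℝ≥0∞ := ENNReal.ofReal (1 / (2 * Real.pi)) with hc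
  have h1 : ∫⁻ θ, frobSq (T' (ζ θ)) ∂μ ≤
      ∫⁻ θ, ((fun θ : ℝ => frobSq (T (ζ θ)) ^ (1 / 2 : ℝ)) + fun _ : ℝ => e : ℝ → ℝ≥0∞) θ ^ (2 : ℝ) ∂μ := by
    refine MeasureTheory.lintegral_mono fun θ => ?_
    rw [← hsq (frobSq (T' (ζ θ)))]
    exact ENNReal.rpow_le_rpow (frobSq_rpow_le_add _ _ hε (h _ (hζ1 θ))) two_pos.le
  have h2 := ENNReal.lintegral_Lp_add_le (μ := μ) hmeas.aemeasurable
    (aemeasurable_const (b := e)) one_le_two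
  have hce : c ^ (1 / 2 : ℝ) * (∫⁻ _, e ^ (2 : ℝ) ∂μ) ^ (1 / 2 : ℝ) = e := by
    rw [← ENNReal.mul_rpow_of_nonneg _ _ (by norm_num), MeasureTheory.lintegral_const, hμ,
      MeasureTheory.Measure.restrict_apply_univ, Real.volume_Ioc, sub_zero, mul_left_comm, hc,
      ← ENNReal.ofReal_mul (by positivity), one_div_mul_cancel (by positivity),
      ENNReal.ofReal_one, mul_one, ← ENNReal.rpow_mul]
    norm_num
  rw [ENNReal.mul_rpow_of_nonneg _ _ (by norm_num), ENNReal.mul_rpow_of_nonneg _ _ (by norm_num)]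
  calc c ^ (1 / 2 : ℝ) * (∫⁻ θ, frobSq (T' (ζ θ)) ∂μ) ^ (1 / 2 : ℝ)
      ≤ c ^ (1 / 2 : ℝ) * ((∫⁻ θ, (frobSq (T (ζ θ)) ^ (1 / 2 : ℝ)) ^ (2 : ℝ) ∂μ) ^ (1 / 2 : ℝ) +
          (∫⁻ _, e ^ (2 : ℝ) ∂μ) ^ (1 / 2 : ℝ)) := by
        gcongr
        exact (ENNReal.rpow_le_rpow h1 (by norm_num)).trans h2
    _ = _ := by
        rw [mul_add, hce]
        simp only [hsq]
        rfl

section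
open scoped Matrix.Norms.L2Operator

/-- Expanding in matrix units bounds the spectral norm by the entries; the constant depends only on
the dimensions. -/
theorem exists_normHinf_le_add (a b : ℕ) : ∃ K : ℝ, 0 ≤ K ∧
    ∀ (T T' : ℂ → Matrix (Fin a) (Fin b) ℂ) (ε : ℝ), 0 ≤ ε →
      (∀ z : ℂ, 1 < ‖z‖ → ∀ i j, ‖T' z i j - T z i j‖ ≤ ε) →
      normHinf T' ≤ normHinf T + ENNReal.ofReal (K * ε) := by
  refine ⟨∑ i : Fin a, ∑ j : Fin b, ‖(Matrix.single i j 1 : Matrix (Fin a) (Fin b) ℂ)‖,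
    by positivity, fun T T' ε hε h => iSup₂_le fun z hz => ?_⟩
  have h1 : ‖T' z - T z‖ ≤
      (∑ i : Fin a, ∑ j : Fin b, ‖(Matrix.single i j 1 : Matrix (Fin a) (Fin b) ℂ)‖) * ε := by
    rw [Matrix.matrix_eq_sum_single (T' z - T z), Finset.sum_mul]
    refine (norm_sum_le _ _).trans (Finset.sum_le_sum fun i _ => ?_)
    rw [Finset.sum_mul]
    refine (norm_sum_le _ _).trans (Finset.sum_le_sum fun j _ => ?_)
    rw [← mul_one ((T' z - T z) i j), ← smul_eq_mul, ← Matrix.smul_single, norm_smul, mul_comm]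
    exact mul_le_mul_of_nonneg_left (h z hz i j) (norm_nonneg _)
  calc ‖T' z‖ₑ = ‖T z + (T' z - T z)‖ₑ := by rw [add_sub_cancel]
    _ ≤ ‖T z‖ₑ + ‖T' z - T z‖ₑ := enorm_add_le _ _
    _ ≤ _ := by
      refine add_le_add (le_iSup₂ (f := fun (z : ℂ) (_ : 1 < ‖z‖) => ‖T z‖ₑ) z hz) ?_
      rw [← ofReal_norm]
      exact ENNReal.ofReal_le_ofReal h1

end

theorem exists_mixedNorm_le_add (a b : ℕ) (lam : ℝ≥0∞) : ∃ K : ℝ, 0 ≤ K ∧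
    ∀ (T T' : ℂ → Matrix (Fin a) (Fin b) ℂ) (ε : ℝ), 0 ≤ ε →
      (∀ i j, ContinuousOn (fun z => T z i j) {z : ℂ | 1 < ‖z‖}) →
      (∀ z : ℂ, 1 < ‖z‖ → ∀ i j, ‖T' z i j - T z i j‖ ≤ ε) →
      mixedNorm lam T' ≤ mixedNorm lam T + ENNReal.ofReal (K * ε) := by
  obtain ⟨K, hK, h⟩ := exists_normHinf_le_add a b
  by_cases hlam : lam = ⊤
  · refine ⟨K, hK, fun T T' ε hε _ hd => ?_⟩
    simp only [mixedNorm, if_pos hlam]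
    exact h T T' ε hε hd
  · refine ⟨a * b + lam.toReal * K, by positivity, fun T T' ε hε hT hd => ?_⟩
    simp only [mixedNorm, if_neg hlam]
    refine (add_le_add (normH2_le_add T T' hε hT hd)
      (mul_le_mul_right (h T T' ε hε hd) lam)).trans (le_of_eq ?_)
    rw [add_mul, ENNReal.ofReal_add (by positivity) (by positivity), mul_assoc lam.toReal,
      ENNReal.ofReal_mul ENNReal.toReal_nonneg, ENNReal.ofReal_toReal hlam]
    ring

end

/-! ### Moving the poles of a feasible response -/

noncomputable section

open Polynomial

theorem norm_le_of_aeval_conjProd_eq_zero {D : ℕ} {p : Fin D → ℂ} {ρ : ℝ} (hp : ∀ i, ‖p i‖ ≤ ρ)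
    {s : ℂ} (hs : aeval s (conjProd p) = 0) : ‖s‖ ≤ ρ := by
  rw [aeval_def, ← eval_map, conjProd_map, eval_prod, Finset.prod_eq_zero_iff] at hs
  obtain ⟨i, -, hi⟩ := hs
  rw [eval_mul, eval_sub, eval_sub, eval_X, eval_C, eval_C, mul_eq_zero, sub_eq_zero,
    sub_eq_zero] at hi
  rcases hi with rfl | rfl
  · exact hp i
  · rw [RCLike.norm_conj]; exact hp i

theorem evalPM_sum_C_smul {a b l : ℕ} (z : ℂ) (c : Fin l → ℝ)
    (W : Fin l → Matrix (Fin a) (Fin b) ℝ[X]) (i j) :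
    evalPM z (∑ t, C (c t) • W t) i j = ∑ t, (c t : ℂ) * evalPM z (W t) i j := by
  simp [evalPM_apply, Matrix.sum_apply]

theorem natDegree_le_pred_of_degree_lt {f g : ℝ[X]} (h : f.degree < g.degree) :
    f.natDegree ≤ g.natDegree - 1 := by
  by_cases h0 : f = 0
  · rw [h0, natDegree_zero]; omega
  · have := natDegree_lt_natDegree h0 h
    omega

theorem conjProd_sub_degree_lt {D : ℕ} (p r : Fin D → ℂ) :
    (conjProd p - conjProd r).degree < (conjProd r).degree := by
  have h : (conjProd p).degree = (conjProd r).degree := by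
    rw [degree_eq_natDegree (conjProd_monic p).ne_zero,
      degree_eq_natDegree (conjProd_monic r).ne_zero, conjProd_natDegree, conjProd_natDegree]
  rw [← h]
  exact degree_sub_lt_left h (conjProd_monic p).ne_zero
    (by rw [(conjProd_monic p).leadingCoeff, (conjProd_monic r).leadingCoeff])

/-- Uniform bound on `|z| > 1` for a combination of proper stable fractions in terms of its
coefficients. -/
theorem exists_bound_sum_evalPM {a b D l : ℕ} {a₁ : ℝ[X]} (ha₁ : a₁.Monic)
    (hstab : ∀ s : ℂ, aeval s a₁ = 0 → ‖s‖ < 1) {ρ : ℝ} (hρ1 : ρ < 1) (hρ0 : 0 ≤ ρ)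
    (W : Fin l → Matrix (Fin a) (Fin b) ℝ[X])
    (hW : ∀ t i j, (W t i j).natDegree ≤ a₁.natDegree + (2 * D + 2 * D)) :
    ∃ K : ℝ, 0 ≤ K ∧ ∀ (p r : Fin D → ℂ) (c : Fin l → ℝ) (ε : ℝ), 0 ≤ ε → (∀ i, ‖p i‖ ≤ ρ) →
      (∀ i, ‖r i‖ ≤ ρ) → (∀ t, |c t| ≤ ε) → ∀ z : ℂ, 1 < ‖z‖ → ∀ i j,
      ‖((aeval z (a₁ * (conjProd p * conjProd r)))⁻¹ • evalPM z (∑ t, C (c t) • W t)) i j‖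
        ≤ K * ε := by
  obtain ⟨ρ', hρ'1, hρ'0, hρ'⟩ := exists_root_bound ha₁.ne_zero hstab
  -- This is the degree of the denominator: numerator and denominator are both compared with ‖z‖^k,
  -- which cancels.
  set k := a₁.natDegree + (2 * D + 2 * D) with hk
  set c₀ : ℝ := (1 - ρ') ^ a₁.natDegree * ((1 - ρ) ^ (2 * D) * (1 - ρ) ^ (2 * D)) with hc₀
  have h1ρ : 0 < 1 - ρ := by linarith
  have h1ρ' : 0 < 1 - ρ' := by linarith
  have hc₀pos : 0 < c₀ := by positivity
  set Q : Fin l → Fin a → Fin b → ℝ := fun t i j =>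
    ∑ u ∈ Finset.range (k + 1), |(W t i j).coeff u| with hQ
  have hQ0 : ∀ t i j, 0 ≤ Q t i j := fun t i j => Finset.sum_nonneg fun _ _ => abs_nonneg _
  refine ⟨(∑ t, ∑ i, ∑ j, Q t i j) / c₀, div_nonneg (Finset.sum_nonneg fun t _ =>
    Finset.sum_nonneg fun i _ => Finset.sum_nonneg fun j _ => hQ0 t i j) hc₀pos.le,
    fun p r c ε hε hp hr hc z hz i j => ?_⟩
  have hlow : c₀ * ‖z‖ ^ k ≤ ‖aeval z (a₁ * (conjProd p * conjProd r))‖ := by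
    have e1 := pow_natDegree_le_norm_aeval ha₁ hρ'1 hρ'0 hρ' hz.le
    have e2 := pow_natDegree_le_norm_aeval (conjProd_monic p) hρ1 hρ0
      (fun s hs => norm_le_of_aeval_conjProd_eq_zero hp hs) hz.le
    have e3 := pow_natDegree_le_norm_aeval (conjProd_monic r) hρ1 hρ0
      (fun s hs => norm_le_of_aeval_conjProd_eq_zero hr hs) hz.le
    rw [conjProd_natDegree] at e2 e3
    rw [map_mul, map_mul, norm_mul, norm_mul]
    calc c₀ * ‖z‖ ^ k = ((1 - ρ') * ‖z‖) ^ a₁.natDegree *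
          (((1 - ρ) * ‖z‖) ^ (2 * D) * ((1 - ρ) * ‖z‖) ^ (2 * D)) := by
          rw [hc₀, hk, pow_add, pow_add, mul_pow, mul_pow]; ring
      _ ≤ _ := by gcongr
  have hzk : 0 < ‖z‖ ^ k := by positivity
  have hup : ‖evalPM z (∑ t, C (c t) • W t) i j‖ ≤ (ε * ∑ t, ∑ i, ∑ j, Q t i j) * ‖z‖ ^ k := by
    rw [evalPM_sum_C_smul, mul_assoc, Finset.sum_mul, Finset.mul_sum]
    refine (norm_sum_le _ _).trans (Finset.sum_le_sum fun t _ => ?_)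
    rw [norm_mul, Complex.norm_real]
    refine mul_le_mul (hc t) ((norm_aeval_le _ (hW t i j) hz.le).trans ?_) (norm_nonneg _) hε
    refine mul_le_mul_of_nonneg_right ?_ hzk.le
    exact (Finset.single_le_sum (f := fun j => Q t i j) (fun j _ => hQ0 t i j)
      (Finset.mem_univ j)).trans (Finset.single_le_sum (f := fun i => ∑ j, Q t i j)
      (fun i _ => Finset.sum_nonneg fun j _ => hQ0 t i j) (Finset.mem_univ i))
  rw [Matrix.smul_apply, smul_eq_mul, norm_mul, norm_inv, inv_mul_le_iff₀
    ((mul_pos hc₀pos hzk).trans_le hlow)]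
  refine hup.trans ?_
  calc (ε * ∑ t, ∑ i, ∑ j, Q t i j) * ‖z‖ ^ k
      = c₀ * ‖z‖ ^ k * ((∑ t, ∑ i, ∑ j, Q t i j) / c₀ * ε) := by field_simp
    _ ≤ _ := by
      refine mul_le_mul_of_nonneg_right hlow (mul_nonneg (div_nonneg ?_ hc₀pos.le) hε)
      exact Finset.sum_nonneg fun t _ =>
        Finset.sum_nonneg fun i _ => Finset.sum_nonneg fun j _ => hQ0 t i j

namespace ControlProblem

variable {n p q m : ℕ} (S : ControlProblem n p q m)

/-- The poles of a pair of closed-loop responses can be moved slightly, at the price of a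
proportional change of the closed-loop transfer function. -/
theorem exists_perturbed_response {D : ℕ} (hD : n + 1 ≤ D) (r : Fin D → ℂ) (hr : ∀ i, ‖r i‖ < 1)
    (M : Matrix (Fin n) (Fin n) ℝ[X]) (N : Matrix (Fin p) (Fin n) ℝ[X])
    (hM : ∀ i j, (M i j).degree < (conjProd r).degree)
    (hN : ∀ i j, (N i j).degree < (conjProd r).degree)
    (heq : S.A.charmatrix * M - S.B.map Polynomial.C * N = conjProd r • 1) :
    ∃ a₁ : ℝ[X], a₁.Monic ∧ a₁ ∣ S.A.charpoly ∧ (∀ s : ℂ, aeval s a₁ = 0 → ‖s‖ < 1) ∧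
    ∃ K : ℝ, 0 ≤ K ∧ ∃ δ : ℝ, 0 < δ ∧ ∀ (w : Fin D → ℂ) (η : ℝ), η < δ → 0 ≤ η →
      (∀ i, ‖w i - r i‖ ≤ η) →
      ∃ (M' : Matrix (Fin n) (Fin n) ℝ[X]) (N' : Matrix (Fin p) (Fin n) ℝ[X]),
        (∀ i j, (M' i j).degree < (a₁ * conjProd w).degree) ∧
        (∀ i j, (N' i j).degree < (conjProd w).degree) ∧
        S.A.charmatrix * M' - a₁ • (S.B.map Polynomial.C * N') = (a₁ * conjProd w) • 1 ∧
        ∀ z : ℂ, 1 < ‖z‖ → ∀ i j,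
          ‖(cplx S.C * ((aeval z (a₁ * conjProd w))⁻¹ • evalPM z M' -
              (aeval z (conjProd r))⁻¹ • evalPM z M) * cplx S.Bhat +
            cplx S.D * ((aeval z (conjProd w))⁻¹ • evalPM z N' -
              (aeval z (conjProd r))⁻¹ • evalPM z N) * cplx S.Bhat) i j‖ ≤ K * η := by
  set d := conjProd r with hd
  have hdm : d.Monic := conjProd_monic r
  have hdD : d.natDegree = 2 * D := conjProd_natDegree r
  obtain ⟨C₀, hC₀, ρ, hρ1, hρ0, δ, hδ, hpert⟩ := conjProd_perturbation r hr
  obtain ⟨a₁, a₂, ha₁, ha₂, ha, ⟨k, hk⟩, hcop⟩ :=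
    exists_coprime_factorization d _ (Matrix.charpoly_monic S.A)
  have hrρ : ∀ i, ‖r i‖ ≤ ρ := (hpert r 0 hδ le_rfl fun i => by simp).1
  have hstab : ∀ s : ℂ, aeval s a₁ = 0 → ‖s‖ < 1 := fun s hs => by
    obtain ⟨b, hb⟩ := hk
    have h1 : aeval s d ^ k = 0 := by rw [← map_pow, hb, map_mul, hs, zero_mul]
    exact (norm_le_of_aeval_conjProd_eq_zero hrρ (eq_zero_of_pow_eq_zero h1)).trans_lt hρ1
  have hdeg : a₁.natDegree + a₂.natDegree = n := by
    rw [← ha₁.natDegree_mul ha₂, ha, Matrix.charpoly_natDegree_eq_dim, Fintype.card_fin]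
  -- Corrections are fixed once for each monomial X^j, independently of the new poles. Combining
  -- them with the coefficients of e makes every later constant uniform.
  choose E F hF hEdeg hFdeg using fun j : Fin (2 * D) =>
    exists_numerator_correction ha₂ hcop (by omega) N hN j (by rw [hdD]; exact j.2)
  set φ := 2 * d.natDegree - 2 - a₂.natDegree with hφ
  have hFφ : ∀ t i j, (F t i j).natDegree ≤ φ := fun t i j => by
    have := hFdeg t i j
    omega
  have hBF : ∀ t i j, ((S.B.map Polynomial.C * F t) i j).natDegree ≤ 0 + φ := fun t =>
    natDegree_matrix_mul_le (natDegree_matrix_C_le _) (hFφ t)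
  have hadjBF : ∀ t i j,
      ((S.A.charmatrix.adjugate * (S.B.map Polynomial.C * F t)) i j).natDegree ≤ n + (0 + φ) :=
    fun t => natDegree_matrix_mul_le (natDegree_adjugate_charmatrix_le _) (hBF t)
  -- The contribution of X^t to the change of the closed loop, as a numerator over a₁ · `conjProd w`
  -- · d. The input part gains the factor a₁ on passing to this denominator.
  set W : Fin (2 * D) → Matrix (Fin m) (Fin q) ℝ[X] := fun t =>
    S.C.map Polynomial.C * (S.A.charmatrix.adjugate * (S.B.map Polynomial.C * F t)) *
      S.Bhat.map Polynomial.C +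
    (a₁ * a₂) • (S.D.map Polynomial.C * F t * S.Bhat.map Polynomial.C) with hW
  have hWdeg : ∀ t i j, (W t i j).natDegree ≤ a₁.natDegree + (2 * D + 2 * D) := fun t i j => by
    simp only [hW, Matrix.add_apply, Matrix.smul_apply, smul_eq_mul]
    refine (natDegree_add_le _ _).trans (max_le ?_ ?_)
    · refine (natDegree_matrix_mul_le (natDegree_matrix_mul_le (natDegree_matrix_C_le _)
        (hadjBF t)) (natDegree_matrix_C_le _) i j).trans ?_
      omega
    · refine (natDegree_mul_le_of_le (ha₁.natDegree_mul ha₂).le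
        (natDegree_matrix_mul_le (natDegree_matrix_mul_le (natDegree_matrix_C_le _)
        (hFφ t)) (natDegree_matrix_C_le _) i j)).trans ?_
      omega
  obtain ⟨K, hK, hbound⟩ := exists_bound_sum_evalPM (D := D) ha₁ hstab hρ1 hρ0 W hWdeg
  refine ⟨a₁, ha₁, ⟨a₂, ha.symm⟩, hstab, K * C₀, by positivity, δ, hδ, fun w η hη hη0 hw => ?_⟩
  obtain ⟨hwρ, hcoeff⟩ := hpert w η hη hη0 hw
  set e := conjProd w - d with he
  have hde : d + e = conjProd w := by rw [he, add_sub_cancel]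
  set c : Fin (2 * D) → ℝ := fun t => e.coeff t with hc
  have hesum : e = ∑ t : Fin (2 * D), Polynomial.C (c t) * X ^ (t : ℕ) := by
    have hlt : e.natDegree < 2 * D := by
      have := natDegree_le_pred_of_degree_lt (conjProd_sub_degree_lt w r)
      rw [← hd, ← he, hdD] at this
      omega
    conv_lhs => rw [as_sum_range_C_mul_X_pow' e hlt]
    rw [Finset.sum_range]
  set Es := ∑ t, Polynomial.C (c t) • E t with hEs
  set Fs := ∑ t, Polynomial.C (c t) • F t with hFs
  have hFE : a₂ • Fs = d • Es - e • N := by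
    rw [hFs, hEs, Finset.smul_sum, Finset.smul_sum]
    conv_rhs => rw [hesum]
    rw [Finset.sum_smul, ← Finset.sum_sub_distrib]
    refine Finset.sum_congr rfl fun t _ => ?_
    rw [smul_comm, hF]
    module
  obtain ⟨M', hM'1, hM'2⟩ := exists_state_numerator S.A S.B hdm ha₁ ha hcop M N Es Fs heq hFE
  rw [hde] at hM'1 hM'2
  have hwm := conjProd_monic w
  have hwD := conjProd_natDegree w
  have hdw : d.degree = (conjProd w).degree := by
    rw [degree_eq_natDegree hdm.ne_zero, degree_eq_natDegree hwm.ne_zero, hdD, hwD]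
  have hFsφ : ∀ i j, (Fs i j).natDegree ≤ φ := fun i j => by
    rw [hFs, Matrix.sum_apply]
    refine natDegree_sum_le_of_forall_le _ _ fun t _ => ?_
    rw [Matrix.smul_apply, smul_eq_mul]
    exact (natDegree_C_mul_le _ _).trans (hFφ t i j)
  refine ⟨M', N + Es, fun i j => ?_, fun i j => ?_, hM'2, fun z hz i j => ?_⟩
  · by_cases h0 : M' i j = 0
    · rw [h0, degree_zero, bot_lt_iff_ne_bot, degree_ne_bot]
      exact (ha₁.mul hwm).ne_zero
    · refine degree_lt_degree ?_
      -- Both terms have degree below deg d + deg(a₁ · `conjProd w`), so dividing by d leaves a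
      -- strictly proper fraction.
      have h1 : (d * M' i j).natDegree ≤ max (a₁.natDegree + 2 * D + (2 * D - 1)) (n + (0 + φ)) := by
        rw [show d * M' i j = a₁ * conjProd w * M i j +
          (S.A.charmatrix.adjugate * (S.B.map Polynomial.C * Fs)) i j from
          congrFun (congrFun hM'1 i) j]
        refine (natDegree_add_le _ _).trans (max_le_max ?_ ?_)
        · refine natDegree_mul_le_of_le ?_ ?_
          · rw [ha₁.natDegree_mul hwm, hwD]
          · rw [← hdD]; exact natDegree_le_pred_of_degree_lt (hM i j)
        · exact natDegree_matrix_mul_le (natDegree_adjugate_charmatrix_le _)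
            (natDegree_matrix_mul_le (natDegree_matrix_C_le _) hFsφ) i j
      rw [hdm.natDegree_mul' h0] at h1
      rw [ha₁.natDegree_mul hwm, hwD]
      rcases le_max_iff.1 h1 with h | h <;> omega
  · rw [Matrix.add_apply]
    refine (degree_add_le _ _).trans_lt (max_lt (hdw ▸ hN i j) (degree_lt_degree ?_))
    rw [hwD, hEs, Matrix.sum_apply]
    refine (natDegree_sum_le_of_forall_le (n := n) _ _ fun t _ => ?_).trans_lt (by omega)
    rw [Matrix.smul_apply, smul_eq_mul]
    exact (natDegree_C_mul_le _ _).trans ((hEdeg t i j).trans (by omega))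
  · have hne : ∀ f : ℝ[X], (∀ s : ℂ, aeval s f = 0 → ‖s‖ ≤ 1) → aeval z f ≠ 0 := fun f hf h0 => by
      have := hf z h0
      linarith
    have hza : aeval z a₁ ≠ 0 := hne _ fun s hs => (hstab s hs).le
    have hzd : aeval z d ≠ 0 := hne _ fun s hs =>
      (norm_le_of_aeval_conjProd_eq_zero hrρ hs).trans hρ1.le
    have hzw : aeval z (conjProd w) ≠ 0 := hne _ fun s hs =>
      (norm_le_of_aeval_conjProd_eq_zero hwρ hs).trans hρ1.le
    set γ : ℂ := aeval z (a₁ * (conjProd w * d)) with hγ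
    have hγ' : γ = aeval z a₁ * (aeval z (conjProd w) * aeval z d) := by
      rw [hγ, map_mul, map_mul]
    have hx : (aeval z (a₁ * conjProd w))⁻¹ • evalPM z M' - (aeval z d)⁻¹ • evalPM z M =
        γ⁻¹ • evalPM z (S.A.charmatrix.adjugate * (S.B.map Polynomial.C * Fs)) := by
      have h1 := congrArg (evalPM z) hM'1
      rw [evalPM_smul, evalPM_add, evalPM_smul] at h1
      rw [← sub_eq_iff_eq_add'] at h1
      rw [← h1, smul_sub, smul_smul, smul_smul, hγ', map_mul]
      congr 2 <;> field_simp
    have hu : (aeval z (conjProd w))⁻¹ • evalPM z (N + Es) - (aeval z d)⁻¹ • evalPM z N =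
        γ⁻¹ • evalPM z ((a₁ * a₂) • Fs) := by
      rw [mul_smul, hFE, evalPM_smul, evalPM_sub, evalPM_smul, evalPM_smul, evalPM_add,
        show aeval z e = aeval z (conjProd w) - aeval z d by rw [he, map_sub], hγ']
      ext i j
      simp only [Matrix.sub_apply, Matrix.smul_apply, Matrix.add_apply, smul_eq_mul]
      field_simp
      ring
    have hsum : cplx S.C * evalPM z (S.A.charmatrix.adjugate * (S.B.map Polynomial.C * Fs)) *
          cplx S.Bhat + cplx S.D * evalPM z ((a₁ * a₂) • Fs) * cplx S.Bhat =
        evalPM z (∑ t, Polynomial.C (c t) • W t) := by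
      have h1 : ∑ t, Polynomial.C (c t) • W t =
          S.C.map Polynomial.C * (S.A.charmatrix.adjugate * (S.B.map Polynomial.C * Fs)) *
            S.Bhat.map Polynomial.C +
          S.D.map Polynomial.C * ((a₁ * a₂) • Fs) * S.Bhat.map Polynomial.C := by
        simp only [hFs, hW, Matrix.mul_sum, Matrix.sum_mul, Finset.smul_sum, Matrix.mul_smul,
          Matrix.smul_mul, ← Finset.sum_add_distrib, smul_add]
        exact Finset.sum_congr rfl fun t _ => by rw [smul_comm (a₁ * a₂)]
      rw [h1]
      simp only [evalPM_add, evalPM_mul, evalPM_C]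
    rw [hx, hu, Matrix.mul_smul, Matrix.smul_mul, Matrix.mul_smul, Matrix.smul_mul, ← smul_add,
      hsum]
    refine (hbound w r c (C₀ * η) (by positivity) hwρ hrρ (fun t => hcoeff t) z hz i j).trans_eq ?_
    ring

end ControlProblem

end

/-! ### Common denominators and the spiral estimate -/

noncomputable section

open Polynomial

/-- Conjugation permutes the roots of a real polynomial with multiplicity, so pairing every root
with its conjugate yields d twice. Squaring thus lets real poles be treated as conjugate pairs. -/
theorem exists_conjProd_eq_mul_self {d : ℝ[X]} (hd : d.Monic)
    (hstab : ∀ s : ℂ, aeval s d = 0 → ‖s‖ < 1) :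
    ∃ r : Fin d.natDegree → ℂ, (∀ i, ‖r i‖ < 1) ∧ conjProd r = d * d := by
  set g := d.map (algebraMap ℝ ℂ) with hg
  have hgm : g.Monic := hd.map _
  obtain ⟨l, hl⟩ : ∃ l : List ℂ, (l : Multiset ℂ) = g.roots := Quot.exists_rep _
  have hlen : l.length = d.natDegree := by
    rw [← Multiset.coe_card, hl, ← (IsAlgClosed.splits g).natDegree_eq_card_roots, hg, natDegree_map]
  rw [← hlen]
  have hprod : ∏ i : Fin l.length, (X - C l[i]) = g := by
    refine (Fin.prod_univ_fun_getElem l fun a => X - C a).trans ?_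
    rw [← Multiset.prod_coe, ← Multiset.map_coe, hl]
    exact ((IsAlgClosed.splits g).eq_prod_roots_of_monic hgm).symm
  have hconj : ∏ i : Fin l.length, (X - C (starRingEnd ℂ l[i])) = g := by
    have h1 := congrArg (Polynomial.map (starRingEnd ℂ)) hprod
    rw [Polynomial.map_prod] at h1
    simp only [Polynomial.map_sub, map_X, map_C] at h1
    rw [h1, hg, Polynomial.map_map]
    congr 1
    ext x
    simp
  refine ⟨fun i => l[i], fun i => hstab _ ?_, ?_⟩
  · have h1 : l[i] ∈ g.roots := by rw [← hl]; exact Multiset.mem_coe.2 (List.getElem_mem _)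
    rw [aeval_def, ← eval_map]
    exact (mem_roots'.1 h1).2
  · refine Polynomial.map_injective _ (algebraMap ℝ ℂ).injective ?_
    rw [conjProd_map, Finset.prod_mul_distrib, hprod, hconj, Polynomial.map_mul]

/-- Numerators of a strictly proper transfer matrix with respect to a common denominator. -/
theorem exists_numerators {a b : ℕ} {Φ : Matrix (Fin a) (Fin b) (RatFunc ℝ)}
    (hΦ : IsStrictlyProperStable Φ) {d : ℝ[X]} (hd : d ≠ 0) (hdvd : ∀ i j, (Φ i j).denom ∣ d) :
    ∃ M : Matrix (Fin a) (Fin b) ℝ[X], (∀ i j, (M i j).degree < d.degree) ∧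
      (∀ z : ℂ, aeval z d ≠ 0 → evalTF Φ z = (aeval z d)⁻¹ • evalPM z M) ∧
      (algebraMap ℝ[X] (RatFunc ℝ) d) • Φ = M.map (algebraMap ℝ[X] (RatFunc ℝ)) := by
  choose k hk using hdvd
  refine ⟨Matrix.of fun i j => (Φ i j).num * k i j, fun i j => ?_, fun z hz => ?_, ?_⟩
  · have hk0 : k i j ≠ 0 := fun h => hd (by rw [hk i j, h, mul_zero])
    rw [Matrix.of_apply, degree_mul]
    conv_rhs => rw [hk i j, degree_mul]
    rw [degree_eq_natDegree hk0]
    exact WithBot.add_lt_add_right (WithBot.natCast_ne_bot _) (hΦ i j).1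
  · ext i j
    have h1 : aeval z d = aeval z (Φ i j).denom * aeval z (k i j) := by
      rw [← map_mul, ← hk i j]
    have h2 := hz
    rw [h1] at h2
    have h3 := left_ne_zero_of_mul h2
    have h4 := right_ne_zero_of_mul h2
    simp only [evalTF, Matrix.map_apply, RatFunc.eval, ← aeval_def, Matrix.smul_apply,
      evalPM_apply, Matrix.of_apply, map_mul, smul_eq_mul]
    rw [h1]
    field_simp
  · ext i j
    have h0 : algebraMap ℝ[X] (RatFunc ℝ) (Φ i j).denom ≠ 0 :=
      RatFunc.algebraMap_ne_zero (RatFunc.denom_ne_zero _)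
    simp only [Matrix.smul_apply, smul_eq_mul, Matrix.map_apply, Matrix.of_apply, map_mul]
    conv_lhs => rw [← RatFunc.num_div_denom (Φ i j)]
    rw [hk i j, map_mul]
    field_simp

theorem exists_common_denominator {a b c e : ℕ} {Φ : Matrix (Fin a) (Fin b) (RatFunc ℝ)}
    {Ψ : Matrix (Fin c) (Fin e) (RatFunc ℝ)} (hΦ : IsStrictlyProperStable Φ)
    (hΨ : IsStrictlyProperStable Ψ) (k : ℕ) :
    ∃ d : ℝ[X], d.Monic ∧ k ≤ d.natDegree ∧ (∀ s : ℂ, aeval s d = 0 → ‖s‖ < 1) ∧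
      (∀ i j, (Φ i j).denom ∣ d) ∧ ∀ i j, (Ψ i j).denom ∣ d := by
  have hm1 : (∏ i, ∏ j, (Φ i j).denom).Monic :=
    monic_prod_of_monic _ _ fun i _ => monic_prod_of_monic _ _ fun j _ => RatFunc.monic_denom _
  have hm2 : (∏ i, ∏ j, (Ψ i j).denom).Monic :=
    monic_prod_of_monic _ _ fun i _ => monic_prod_of_monic _ _ fun j _ => RatFunc.monic_denom _
  -- The factor X^k adds only the stable root 0 and supplies the degree that the correction step
  -- needs.
  refine ⟨X ^ k * ((∏ i, ∏ j, (Φ i j).denom) * ∏ i, ∏ j, (Ψ i j).denom),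
    (monic_X_pow k).mul (hm1.mul hm2), ?_, fun s hs => ?_, fun i j => ?_, fun i j => ?_⟩
  · rw [(monic_X_pow k).natDegree_mul (hm1.mul hm2), natDegree_X_pow]
    exact Nat.le_add_right _ _
  · rw [map_mul, map_mul, map_pow, aeval_X, mul_eq_zero, mul_eq_zero, map_prod, map_prod,
      Finset.prod_eq_zero_iff, Finset.prod_eq_zero_iff] at hs
    rcases hs with hs | ⟨i, -, hs⟩ | ⟨i, -, hs⟩
    · rw [eq_zero_of_pow_eq_zero hs, norm_zero]
      exact one_pos
    · rw [map_prod, Finset.prod_eq_zero_iff] at hs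
      obtain ⟨j, -, hs⟩ := hs
      exact (hΦ i j).2 s hs
    · rw [map_prod, Finset.prod_eq_zero_iff] at hs
      obtain ⟨j, -, hs⟩ := hs
      exact (hΨ i j).2 s hs
  · exact ((Finset.dvd_prod_of_mem (fun j => (Φ i j).denom) (Finset.mem_univ j)).trans
      (Finset.dvd_prod_of_mem (fun i => ∏ j, (Φ i j).denom) (Finset.mem_univ i))).trans
      ((dvd_mul_right _ _).trans (dvd_mul_left _ _))
  · exact ((Finset.dvd_prod_of_mem (fun j => (Ψ i j).denom) (Finset.mem_univ j)).trans
      (Finset.dvd_prod_of_mem (fun i => ∏ j, (Ψ i j).denom) (Finset.mem_univ i))).trans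
      ((dvd_mul_left _ _).trans (dvd_mul_left _ _))

theorem charmatrix_map_algebraMap {n : ℕ} (A : Matrix (Fin n) (Fin n) ℝ) :
    A.charmatrix.map (algebraMap ℝ[X] (RatFunc ℝ)) =
      Matrix.scalar (Fin n) (RatFunc.X : RatFunc ℝ) - constTF A := by
  ext i j
  by_cases h : i = j <;>
    simp [constTF, Matrix.diagonal, h]

theorem conjProd_map_eq_prod_finset {D : ℕ} {w : Fin D → ℂ} (hw : Function.Injective w)
    (hdisj : ∀ i j, w i ≠ starRingEnd ℂ (w j)) :
    (conjProd w).map (algebraMap ℝ ℂ) =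
      ∏ s ∈ Finset.univ.image w ∪ Finset.univ.image (fun i => starRingEnd ℂ (w i)),
        (X - C s) := by
  rw [conjProd_map, Finset.prod_mul_distrib, Finset.prod_union, Finset.prod_image hw.injOn,
    Finset.prod_image fun i _ j _ h => hw ((starRingEnd ℂ).injective h)]
  rw [Finset.disjoint_left]
  intro z hz hz'
  obtain ⟨i, -, rfl⟩ := Finset.mem_image.1 hz
  obtain ⟨j, -, hj⟩ := Finset.mem_image.1 hz'
  exact hdisj i j hj.symm

namespace ControlProblem

variable {n p q m : ℕ} (S : ControlProblem n p q m)

/-- A feasible pair of responses as fractions with a common denominator which is a product of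
conjugate pairs. -/
theorem Feasible.exists_fraction {S : ControlProblem n p q m}
    {Φx : Matrix (Fin n) (Fin n) (RatFunc ℝ)} {Φu : Matrix (Fin p) (Fin n) (RatFunc ℝ)}
    (h : S.Feasible Φx Φu) : ∃ (D : ℕ) (r : Fin D → ℂ) (M : Matrix (Fin n) (Fin n) ℝ[X])
      (N : Matrix (Fin p) (Fin n) ℝ[X]), n + 1 ≤ D ∧ (∀ i, ‖r i‖ < 1) ∧
      (∀ i j, (M i j).degree < (conjProd r).degree) ∧
      (∀ i j, (N i j).degree < (conjProd r).degree) ∧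
      S.A.charmatrix * M - S.B.map Polynomial.C * N = conjProd r • 1 ∧
      ∀ z : ℂ, 1 < ‖z‖ → evalTF Φx z = (aeval z (conjProd r))⁻¹ • evalPM z M ∧
        evalTF Φu z = (aeval z (conjProd r))⁻¹ • evalPM z N := by
  obtain ⟨heq, hx, hu⟩ := h
  obtain ⟨d, hdm, hdeg, hstab, hdx, hdu⟩ := exists_common_denominator hx hu (n + 1)
  obtain ⟨r, hr, hrd⟩ := exists_conjProd_eq_mul_self hdm hstab
  have hd0 := (conjProd_monic r).ne_zero
  have hdr : d ∣ conjProd r := hrd ▸ dvd_mul_right _ _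
  obtain ⟨M, hM, hMz, hMΦ⟩ := exists_numerators hx hd0 fun i j => (hdx i j).trans hdr
  obtain ⟨N, hN, hNz, hNΦ⟩ := exists_numerators hu hd0 fun i j => (hdu i j).trans hdr
  refine ⟨_, r, M, N, hdeg, hr, hM, hN, ?_, fun z hz => ?_⟩
  · refine Matrix.map_injective (RatFunc.algebraMap_injective ℝ) ?_
    have h1 := congrArg (algebraMap ℝ[X] (RatFunc ℝ) (conjProd r) • ·) heq
    simp only [smul_sub, ← Matrix.mul_smul, hMΦ, hNΦ] at h1
    rw [← charmatrix_map_algebraMap] at h1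
    have hB : constTF S.B = (S.B.map Polynomial.C).map (algebraMap ℝ[X] (RatFunc ℝ)) := by
      ext i j
      simp [constTF]
    rw [hB, ← Matrix.map_mul, ← Matrix.map_mul, ← Matrix.map_sub _ (map_sub _)] at h1
    refine h1.trans ?_
    ext i j
    by_cases hij : i = j <;> simp [hij]
  · have hz0 : aeval z (conjProd r) ≠ 0 := fun h0 => by
      rw [hrd, map_mul, mul_self_eq_zero] at h0
      have := hstab z h0
      linarith
    exact ⟨hMz z hz0, hNz z hz0⟩

/-- Supplies the measurability required by the H₂ estimate; this is where the analyticity of the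
desired response enters. -/
theorem continuousOn_closedLoop {D : ℕ} {r : Fin D → ℂ} (hr : ∀ i, ‖r i‖ < 1)
    (M : Matrix (Fin n) (Fin n) ℝ[X]) (N : Matrix (Fin p) (Fin n) ℝ[X])
    (hT : ∀ i j, DifferentiableOn ℂ (fun z : ℂ => S.Tdes z i j) {z : ℂ | 1 < ‖z‖}) (i j) :
    ContinuousOn (fun z => (cplx S.C * ((aeval z (conjProd r))⁻¹ • evalPM z M) * cplx S.Bhat +
      cplx S.D * ((aeval z (conjProd r))⁻¹ • evalPM z N) * cplx S.Bhat - S.Tdes z) i j)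
      {z : ℂ | 1 < ‖z‖} := by
  have h1 : ∀ z : ℂ, (cplx S.C * ((aeval z (conjProd r))⁻¹ • evalPM z M) * cplx S.Bhat +
      cplx S.D * ((aeval z (conjProd r))⁻¹ • evalPM z N) * cplx S.Bhat - S.Tdes z) i j =
      (aeval z (conjProd r))⁻¹ * aeval z ((S.C.map Polynomial.C * M * S.Bhat.map Polynomial.C +
        S.D.map Polynomial.C * N * S.Bhat.map Polynomial.C) i j) - S.Tdes z i j := fun z => by
    rw [← evalPM_apply]
    simp only [evalPM_add, evalPM_mul, evalPM_C, Matrix.mul_smul, Matrix.smul_mul, ← smul_add,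
      Matrix.sub_apply, Matrix.smul_apply, smul_eq_mul]
  simp only [h1]
  refine ContinuousOn.sub (ContinuousOn.mul (ContinuousOn.inv₀ ?_ fun z hz h0 => ?_) ?_)
    (hT i j).continuousOn
  · exact (Polynomial.continuous_aeval _).continuousOn
  · obtain ⟨ρ, hρ⟩ : ∃ ρ : ℝ, ρ ≤ 1 ∧ ∀ i, ‖r i‖ ≤ ρ := ⟨1, le_rfl, fun i => (hr i).le⟩
    exact absurd hz (not_lt.2 ((norm_le_of_aeval_conjProd_eq_zero hρ.2 h0).trans hρ.1))
  · exact (Polynomial.continuous_aeval _).continuousOn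

/-- The simple pole approximation with poles on the spiral attains the optimal cost up to an
additive error of order `k ^ (-1/2)`. -/
theorem exists_Jspa_le_add
    (hT : ∀ i j, DifferentiableOn ℂ (fun z : ℂ => S.Tdes z i j) {z : ℂ | 1 < ‖z‖})
    {Φx : Matrix (Fin n) (Fin n) (RatFunc ℝ)} {Φu : Matrix (Fin p) (Fin n) (RatFunc ℝ)}
    (hopt : S.IsOptimal Φx Φu) :
    ∃ K : ℝ, 0 ≤ K ∧ ∃ N : ℕ, 0 < N ∧ ∀ k : ℕ, N ≤ k →
      S.Jspa (spiralPoles k) ≤ S.Jstar + ENNReal.ofReal (K / Real.sqrt k) := by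
  obtain ⟨hfeas, hcost⟩ := hopt
  obtain ⟨D, r, M, N, hD, hr, hM, hN, heq, heval⟩ := hfeas.exists_fraction
  obtain ⟨a₁, ha₁, hadvd, hastab, K₁, hK₁, δ, hδ, hpert⟩ :=
    S.exists_perturbed_response hD r hr M N hM hN heq
  obtain ⟨K₂, N₂, hspiral⟩ := exists_injective_spiralPole_near r hr
  obtain ⟨K₃, hK₃, hnorm⟩ := exists_mixedNorm_le_add m q S.lam
  -- Beyond this index the displacement |K₂|/√k is below the radius δ in which the perturbation
  -- bound holds.
  obtain ⟨N₃, hN₃⟩ := exists_nat_gt ((|K₂| / δ) ^ 2)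
  refine ⟨K₃ * (K₁ * |K₂|), by positivity, N₂ + N₃ + 1, by omega, fun k hk => ?_⟩
  have hk0 : 0 < k := by omega
  have hsk : 0 < Real.sqrt k := Real.sqrt_pos.2 (by exact_mod_cast hk0)
  obtain ⟨κ, hκ, hκr⟩ := hspiral k (by omega)
  set w : Fin D → ℂ := fun i => spiralPole k (κ i) with hw
  set η : ℝ := |K₂| / Real.sqrt k with hη
  have hη0 : 0 ≤ η := by positivity
  have hηδ : η < δ := by
    rw [hη, div_lt_comm₀ hsk hδ]
    refine Real.lt_sqrt_of_sq_lt (hN₃.trans_le ?_)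
    exact_mod_cast (by omega : N₃ ≤ k)
  obtain ⟨M', N', hM', hN', heq', hbound⟩ := hpert w η hηδ hη0 fun i =>
    (hκr i).2.trans (div_le_div_of_nonneg_right (le_abs_self _) hsk.le)
  have hwinj : Function.Injective w := fun i j h =>
    hκ (index_eq_of_norm_spiralPole_eq hk0 (congrArg norm h))
  have hwconj : ∀ i j, w i ≠ starRingEnd ℂ (w j) := fun i j h => by
    have hij : κ i = κ j := index_eq_of_norm_spiralPole_eq hk0
      ((congrArg norm h).trans (RCLike.norm_conj _))
    have h2 : spiralPole k (κ j) = starRingEnd ℂ (spiralPole k (κ j)) := by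
      rw [hw] at h
      simp only at h
      rwa [hij] at h
    exact spiralPole_im_ne_zero hk0 (Finset.mem_Ico.1 (hκr j).1).1 (Complex.conj_eq_iff_im.1 h2.symm)
  have hP : ∀ s ∈ spiralPoles k, ‖s‖ < 1 := fun s hs => by
    rcases Finset.mem_union.1 hs with hs | hs
    · obtain ⟨l, hl, rfl⟩ := Finset.mem_image.1 hs
      exact spiralPole_norm_lt_one (Finset.mem_Ico.1 hl).2
    · obtain ⟨l, hl, rfl⟩ := Finset.mem_image.1 hs
      rw [RCLike.norm_conj]
      exact spiralPole_norm_lt_one (Finset.mem_Ico.1 hl).2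
  have hsub : Finset.univ.image w ∪ Finset.univ.image (fun i => starRingEnd ℂ (w i)) ⊆
      spiralPoles k := by
    refine Finset.union_subset_union ?_ ?_
    · exact Finset.image_subset_iff.2 fun i _ => Finset.mem_image_of_mem _ (hκr i).1
    · exact Finset.image_subset_iff.2 fun i _ =>
        Finset.mem_image_of_mem (fun l => starRingEnd ℂ (spiralPole k l)) (hκr i).1
  obtain ⟨c, hc, hcz⟩ := S.exists_spaCoeffs (spiralPoles k) _ hP hsub (conjProd w) a₁
    (conjProd_map_eq_prod_finset hwinj hwconj) ha₁ hadvd hastab M' N' hM' hN' heq'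
  refine (iInf₂_le c hc).trans ?_
  rw [← hcost, cost, cost]
  have h1 := hnorm (fun z => cplx S.C * evalTF Φx z * cplx S.Bhat +
      cplx S.D * evalTF Φu z * cplx S.Bhat - S.Tdes z)
    (fun z => cplx S.C * S.spaX (spiralPoles k) c z * cplx S.Bhat +
      cplx S.D * spaU (spiralPoles k) c z * cplx S.Bhat - S.Tdes z) (K₁ * η) (by positivity)
    (fun i j => (S.continuousOn_closedLoop hr M N hT i j).congr fun z hz => by
      simp only [(heval z hz).1, (heval z hz).2])
    (fun z hz i j => by
      refine le_trans (le_of_eq ?_) (hbound z hz i j)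
      rw [(heval z hz).1, (heval z hz).2, (hcz z hz).1, (hcz z hz).2, ← Matrix.sub_apply]
      refine congrArg (fun Q : Matrix (Fin m) (Fin q) ℂ => ‖Q i j‖) ?_
      rw [sub_sub_sub_cancel_right, Matrix.mul_sub, Matrix.sub_mul, Matrix.mul_sub,
        Matrix.sub_mul]
      exact add_sub_add_comm _ _ _ _)
  refine h1.trans (le_of_eq ?_)
  rw [hη]
  congr 2
  ring

end ControlProblem

end
theorem corollary1 {n p q m : ℕ} (S : ControlProblem n p q m)
    (hT : ∀ i j, DifferentiableOn ℂ (fun z : ℂ => S.Tdes z i j) {z : ℂ | 1 < ‖z‖})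
    (Φx : Matrix (Fin n) (Fin n) (RatFunc ℝ)) (Φu : Matrix (Fin p) (Fin n) (RatFunc ℝ))
    (hopt : S.IsOptimal Φx Φu)
    (hJpos : 0 < S.Jstar) (hJfin : S.Jstar < ⊤) :
    ∃ K : ℝ, 0 < K ∧ ∃ N : ℕ, 0 < N ∧ ∀ k : ℕ, N ≤ k →
      (spiralPoles k).card + 2 = 2 * k ∧
      S.Jspa (spiralPoles k) < ⊤ ∧
      ((S.Jspa (spiralPoles k)).toReal - S.Jstar.toReal) / S.Jstar.toReal
        ≤ K / Real.sqrt (k : ℝ) := by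
  obtain ⟨K, hK, N, hN, h⟩ := S.exists_Jspa_le_add hT hopt
  have hJ : 0 < S.Jstar.toReal := ENNReal.toReal_pos hJpos.ne' hJfin.ne
  -- The additive constant may be zero; adding 1 makes the relative one positive.
  refine ⟨K / S.Jstar.toReal + 1, by positivity, N, hN, fun k hk => ?_⟩
  have hsum : S.Jstar + ENNReal.ofReal (K / Real.sqrt k) < ⊤ :=
    ENNReal.add_lt_top.2 ⟨hJfin, ENNReal.ofReal_lt_top⟩
  refine ⟨spiralPoles_card (hN.trans_le hk), (h k hk).trans_lt hsum, ?_⟩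
  have h1 := ENNReal.toReal_mono hsum.ne (h k hk)
  rw [ENNReal.toReal_add hJfin.ne ENNReal.ofReal_ne_top, ENNReal.toReal_ofReal (by positivity)] at h1
  calc ((S.Jspa (spiralPoles k)).toReal - S.Jstar.toReal) / S.Jstar.toReal
      ≤ (K / Real.sqrt k) / S.Jstar.toReal :=
        div_le_div_of_nonneg_right (by linarith) hJ.le
    _ = K / S.Jstar.toReal / Real.sqrt k := div_right_comm _ _ _
    _ ≤ (K / S.Jstar.toReal + 1) / Real.sqrt k :=
        div_le_div_of_nonneg_right (by linarith) (Real.sqrt_nonneg _)
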